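/- Let $m\ge 1$, $n,r\ge 0$ be integers and let $$G(\lambda)=P(\lambda)+C(\lambda E-A)^{-1}B\in\mathbb{C}(\lambda)^{n\times n},\qquad P(\lambda)=\sum_{j=0}^{m}\lambda^jA_j,\quad A_m\neq 0,$$ where $A_j\in\mathbb{C}^{n\times n}$, $E,A\in\mathbb{C}^{r\times r}$ with $E$ nonsingular, $C\in\mathbb{C}^{n\times r}$, $B\in\mathbb{C}^{r\times n}$. Assume that this realization is minimal, i.e. that no realization of $G$ of this form (an arbitrary matrix polynomial plus $C'(\lambda E'-A')^{-1}B'$ with $E'$ nonsingular) has a pencil $\lambda E'-A'$ of size smaller than $r$. Let $$\mathcal S(\lambda)=\begin{bmatrix}P(\lambda)&C\\ B&A-\lambda E\end{bmatrix}$$ be the associated system matrix; a system matrix is called irreducible if its realization is minimal. *Fiedler matrices.* Let $e_j$ be the $j$-th column of $I_m$. Put $M^P_{-m}=\operatorname{diag}(A_m,I_{(m-1)n})$, $M^P_0=\operatorname{diag}(I_{(m-1)n},-A_0)$, and $$M^P_i=\operatorname{diag}\left(I_{(m-i-1)n},\begin{bmatrix}-A_i&I_n\\ I_n&0\end{bmatrix},I_{(i-1)n}\right)\quad(1\le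 i\le m-1),$$ $$\mathbb M^{\mathcal S}_{-m}=\begin{bmatrix}M^P_{-m}&0\\0&-E\end{bmatrix},\quad \mathbb M^{\mathcal S}_0=\begin{bmatrix}M^P_0&-e_m\otimes C\\-e_m^T\otimes B&-A\end{bmatrix},\quad \mathbb M^{\mathcal S}_i=\begin{bmatrix}M^P_i&0\\0&I_r\end{bmatrix}\ (1\le i\le m-1).$$ For a permutation $\sigma=(\sigma_1,\dots,\sigma_m)$ of $\{0,\dots,m-1\}$ let $M^P_\sigma=M^P_{\sigma_1}\cdots M^P_{\sigma_m}$, $\mathbb M^{\mathcal S}_\sigma=\mathbb M^{\mathcal S}_{\sigma_1}\cdots\mathbb M^{\mathcal S}_{\sigma_m}$, and let $$L_\sigma(\lambda)=\lambda M^P_{-m}-M^P_\sigma,\qquad \mathbb L_\sigma(\lambda)=\lambda\mathbb M^{\mathcal S}_{-m}-\mathbb M^{\mathcal S}_\sigma$$ be the Fiedler pencils of $P(\lambda)$ and $G(\lambda)$ associated with $\sigma$. Let $c_0(\sigma)$ (resp. $i_0(\sigma)$) be the integer $p\ge 0$ such that $(0,1,\dots,p)$ (resp. $(p,\dots,1,0)$)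 is a subsequence of $\sigma$ and $(0,1,\dots,p+1)$ (resp. $(p+1,\dots,1,0)$) is not. *Rosenbrock strong linearization.* A square matrix polynomial is unimodular if its determinant is a nonzero constant; a square rational matrix is biproper if it tends to a nonsingular constant matrix as $\lambda\to\infty$. An $(mn+r)\times(mn+r)$ irreducible system matrix $$\mathbb L(\lambda)=\begin{bmatrix}\mathcal X-\lambda\mathcal Y&\mathcal C\\ \mathcal B&H-\lambda K\end{bmatrix},\qquad H,K\in\mathbb C^{r\times r},\ K \text{ nonsingular},$$ with transfer function $\mathbb G(\lambda)=\mathcal X-\lambda\mathcal Y+\mathcal C(\lambda K-H)^{-1}\mathcal B$ is a Rosenbrock strong linearization of $G(\lambda)$ if (a) and (b) below hold for $\mathbb L$ and $\mathbb G$. **Theorem.** For every permutation $\sigma$ of $\{0,\dots,m-1\}$ the Fiedler pencil $\mathbb L_\sigma(\lambda)$ is a Rosenbrock strong linearization of $G(\lambda)$; in particular it is an irreducible system matrix. More precisely: (a) There are $mn\times mn$ unimodular matrix polynomials $U(\lambda),V(\lambda)$ and nonsingular $U_0,V_0\in\mathbb C^{r\times r}$ with $$\begin{bmatrix}U(\lambda)&0\\0&U_0\end{bmatrix}\mathbb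 L_\sigma(\lambda)\begin{bmatrix}V(\lambda)&0\\0&V_0\end{bmatrix}=\begin{bmatrix}I_{(m-1)n}&0\\0&\mathcal S(\lambda)\end{bmatrix}.$$ (b) $\mathbb L_\sigma(\lambda)=\begin{bmatrix}L_\sigma(\lambda)&e_{m-i_0(\sigma)}\otimes C\\ e^T_{m-c_0(\sigma)}\otimes B&A-\lambda E\end{bmatrix}$, so that its transfer function is $\mathbb G(\lambda)=L_\sigma(\lambda)+(e_{m-i_0(\sigma)}\otimes C)(\lambda E-A)^{-1}(e^T_{m-c_0(\sigma)}\otimes B)$, and there are $mn\times mn$ biproper rational matrices $\mathcal O_\ell(\lambda),\mathcal O_r(\lambda)$ with $$\mathcal O_\ell(\lambda)\,\lambda^{-1}\mathbb G(\lambda)\,\mathcal O_r(\lambda)=\begin{bmatrix}I_{(m-1)n}&0\\0&\lambda^{-m}G(\lambda)\end{bmatrix}.$$ -/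

import Mathlib

open Polynomial

namespace Fiedler

noncomputable section

/-- A constant matrix, viewed as a matrix polynomial. -/
def const {ι κ : Type*} (M : Matrix ι κ ℂ) : Matrix ι κ ℂ[X] :=
  M.map (fun c => Polynomial.C c)

/-- A matrix polynomial, viewed as a rational matrix. -/
def toRat {ι κ : Type*} (P : Matrix ι κ ℂ[X]) : Matrix ι κ (RatFunc ℂ) :=
  P.map (algebraMap ℂ[X] (RatFunc ℂ))

/-- The matrix polynomial `∑_{j=0}^m λ^j A_j`. -/
def matPoly {ι : Type*} {m : ℕ} (A : Fin (m + 1) → Matrix ι ι ℂ) : Matrix ι ι ℂ[X] :=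
  ∑ j : Fin (m + 1), (X : ℂ[X]) ^ (j : ℕ) • const (A j)

/-! ### Realizations and system matrices -/

/-- The data of a realization `P(λ) + C (λ E - A)⁻¹ B` with an `r × r` pencil `λ E - A`,
`E` nonsingular. -/
structure Realization (ι : Type*) (r : ℕ) where
  P : Matrix ι ι ℂ[X]
  C : Matrix ι (Fin r) ℂ
  E : Matrix (Fin r) (Fin r) ℂ
  A : Matrix (Fin r) (Fin r) ℂ
  B : Matrix (Fin r) ι ℂ
  det_E : E.det ≠ 0

/-- The transfer function `P(λ) + C (λ E - A)⁻¹ B`, i.e. the rational matrix that is realized. -/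
def Realization.transfer {ι : Type*} {r : ℕ} (S : Realization ι r) :
    Matrix ι ι (RatFunc ℂ) :=
  toRat S.P +
    toRat (const S.C) * (toRat ((X : ℂ[X]) • const S.E - const S.A))⁻¹ * toRat (const S.B)

/-- The system matrix `[P(λ), C; B, A - λ E]`. -/
def Realization.systemMatrix {ι : Type*} {r : ℕ} (S : Realization ι r) :
    Matrix (ι ⊕ Fin r) (ι ⊕ Fin r) ℂ[X] :=
  Matrix.fromBlocks S.P (const S.C) (const S.B) (const S.A - (X : ℂ[X]) • const S.E)

/-- The realization is minimal (its system matrix is irreducible): no realization of the same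
rational matrix has a smaller pencil. -/
def Realization.IsMinimal {ι : Type*} {r : ℕ} (S : Realization ι r) : Prop :=
  ∀ (s : ℕ) (T : Realization ι s), T.transfer = S.transfer → r ≤ s

/-! ### Unimodular and biproper matrices -/

/-- The determinant is a nonzero constant. -/
def IsUnimodular {ι : Type*} [Fintype ι] [DecidableEq ι] (U : Matrix ι ι ℂ[X]) : Prop :=
  ∃ c : ℂ, c ≠ 0 ∧ U.det = Polynomial.C c

/-- `F(λ)` tends to a nonsingular matrix as `λ → ∞`. -/
def IsBiproper {ι : Type*} [Fintype ι] [DecidableEq ι] (F : Matrix ι ι (RatFunc ℂ)) : Prop :=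
  ∃ D : Matrix ι ι ℂ,
    Filter.Tendsto (fun z : ℂ => F.map (fun f => RatFunc.eval (RingHom.id ℂ) z f))
      (Bornology.cobounded ℂ) (nhds D) ∧ D.det ≠ 0

/-! ### Block matrices

Rows and columns of an `mn × mn` matrix are indexed by `Fin m × Fin n`; the pair `(p, a)` is
position `a` inside block `p + 1`. -/

/-- `diag(I_{(m-1)n}, Y)`; this is also the elementary matrix `M_0(Y)`. -/
def elemZero (m : ℕ) {n : ℕ} {R : Type*} [Zero R] [One R] (Y : Matrix (Fin n) (Fin n) R) :
    Matrix (Fin m × Fin n) (Fin m × Fin n) R :=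
  Matrix.comp (Fin m) (Fin m) (Fin n) (Fin n) R <| Matrix.of fun p q =>
    if p = q then (if (p : ℕ) + 1 = m then Y else 1) else 0

/-- The elementary matrix `M_i(Y)` for `1 ≤ i ≤ m - 1`: the identity, except that the
blocks in rows and columns `m - i`, `m - i + 1` are `[Y, I; I, 0]`. -/
def elemPos (m i : ℕ) {n : ℕ} (Y : Matrix (Fin n) (Fin n) ℂ) :
    Matrix (Fin m × Fin n) (Fin m × Fin n) ℂ :=
  Matrix.comp (Fin m) (Fin m) (Fin n) (Fin n) ℂ <| Matrix.of fun p q =>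
    if (p : ℕ) + i + 1 = m ∧ (q : ℕ) + i + 1 = m then Y
    else if (p : ℕ) + i + 1 = m ∧ (q : ℕ) + i = m then 1
    else if (p : ℕ) + i = m ∧ (q : ℕ) + i + 1 = m then 1
    else if (p : ℕ) + i = m ∧ (q : ℕ) + i = m then 0
    else if p = q then 1 else 0

/-- The elementary matrix `M_{-m}(Y) = diag(Y, I_{(m-1)n})`. -/
def elemNegTop (m : ℕ) {n : ℕ} (Y : Matrix (Fin n) (Fin n) ℂ) :
    Matrix (Fin m × Fin n) (Fin m × Fin n) ℂ :=
  Matrix.comp (Fin m) (Fin m) (Fin n) (Fin n) ℂ <| Matrix.of fun p q =>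
    if p = q then (if (p : ℕ) = 0 then Y else 1) else 0

/-- The block column `e_{m-k} ⊗ Y`. -/
def blockCol (m k : ℕ) {n r : ℕ} {R : Type*} [Zero R] (Y : Matrix (Fin n) (Fin r) R) :
    Matrix (Fin m × Fin n) (Fin r) R :=
  Matrix.of fun p b => if (p.1 : ℕ) + k + 1 = m then Y p.2 b else 0

/-- The block row `e_{m-k}^T ⊗ Y`. -/
def blockRow (m k : ℕ) {n r : ℕ} {R : Type*} [Zero R] (Y : Matrix (Fin r) (Fin n) R) :
    Matrix (Fin r) (Fin m × Fin n) R :=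
  Matrix.of fun a q => if (q.1 : ℕ) + k + 1 = m then Y a q.2 else 0

/-- `diag(I_{(m-1)n}, Y)` for an `(n + r) × (n + r)` matrix `Y`: the first `n` rows and columns
of `Y` occupy block `m`. -/
def diagOne (m : ℕ) {n r : ℕ} {R : Type*} [Zero R] [One R]
    (Y : Matrix (Fin n ⊕ Fin r) (Fin n ⊕ Fin r) R) :
    Matrix ((Fin m × Fin n) ⊕ Fin r) ((Fin m × Fin n) ⊕ Fin r) R :=
  Matrix.fromBlocks (elemZero m Y.toBlocks₁₁) (blockCol m 0 Y.toBlocks₁₂)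
    (blockRow m 0 Y.toBlocks₂₁) Y.toBlocks₂₂

/-! ### Rosenbrock strong linearizations -/

/-- `diag(U, U₀) L diag(V, V₀) = diag(I_{(m-1)n}, S(λ))` for some unimodular `U`, `V` and
nonsingular constant `U₀`, `V₀`. -/
def SystemEquivalent {m n r : ℕ} (S : Realization (Fin n) r)
    (L : Matrix ((Fin m × Fin n) ⊕ Fin r) ((Fin m × Fin n) ⊕ Fin r) ℂ[X]) : Prop :=
  ∃ (U V : Matrix (Fin m × Fin n) (Fin m × Fin n) ℂ[X]) (U₀ V₀ : Matrix (Fin r) (Fin r) ℂ),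
    IsUnimodular U ∧ IsUnimodular V ∧ U₀.det ≠ 0 ∧ V₀.det ≠ 0 ∧
    Matrix.fromBlocks U 0 0 (const U₀) * L * Matrix.fromBlocks V 0 0 (const V₀)
      = diagOne m S.systemMatrix

/-- `O_ℓ λ⁻¹ H(λ) O_r = diag(I_{(m-1)n}, λ^{-m} G(λ))` for some biproper `O_ℓ`, `O_r`. -/
def BiproperEquivalent {m n : ℕ} (G : Matrix (Fin n) (Fin n) (RatFunc ℂ))
    (H : Matrix (Fin m × Fin n) (Fin m × Fin n) (RatFunc ℂ)) : Prop :=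
  ∃ Ol Or : Matrix (Fin m × Fin n) (Fin m × Fin n) (RatFunc ℂ),
    IsBiproper Ol ∧ IsBiproper Or ∧
    Ol * ((RatFunc.X : RatFunc ℂ)⁻¹ • H) * Or
      = elemZero m (((RatFunc.X : RatFunc ℂ) ^ m)⁻¹ • G)

/-- `L` is an irreducible system matrix `[𝒳 - λ 𝒴, 𝒞; ℬ, H - λ K]` with `K` nonsingular, and is a
Rosenbrock strong linearization of the rational matrix `G = S.transfer` with system
matrix `S.systemMatrix`. -/
def IsRosenbrockStrongLinearization {m n r : ℕ} (S : Realization (Fin n) r)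
    (L : Matrix ((Fin m × Fin n) ⊕ Fin r) ((Fin m × Fin n) ⊕ Fin r) ℂ[X]) : Prop :=
  ∃ T : Realization (Fin m × Fin n) r,
    (∃ Xc Yc : Matrix (Fin m × Fin n) (Fin m × Fin n) ℂ,
      T.P = const Xc - (X : ℂ[X]) • const Yc) ∧
    L = T.systemMatrix ∧ T.IsMinimal ∧
    SystemEquivalent S L ∧ BiproperEquivalent S.transfer T.transfer

/-! ### Fiedler matrices and Fiedler pencils -/

/-- The Fiedler matrix `M^P_i`, `0 ≤ i ≤ m - 1`, of `P(λ) = ∑ λ^j A_j`. -/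
def fiedlerP {m n : ℕ} (A : Fin (m + 1) → Matrix (Fin n) (Fin n) ℂ) (i : Fin m) :
    Matrix (Fin m × Fin n) (Fin m × Fin n) ℂ :=
  if (i : ℕ) = 0 then elemZero m (-A i.castSucc) else elemPos m i (-A i.castSucc)

/-- The Fiedler matrix `M^P_{-m}`. -/
def fiedlerPNeg {m n : ℕ} (A : Fin (m + 1) → Matrix (Fin n) (Fin n) ℂ) :
    Matrix (Fin m × Fin n) (Fin m × Fin n) ℂ :=
  elemNegTop m (A (Fin.last m))

/-- The Fiedler matrix `𝕄^S_i`, `0 ≤ i ≤ m - 1`, of the system matrix; `A` are the coefficients of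
its polynomial part. -/
def fiedlerS {m n r : ℕ} (A : Fin (m + 1) → Matrix (Fin n) (Fin n) ℂ)
    (S : Realization (Fin n) r) (i : Fin m) :
    Matrix ((Fin m × Fin n) ⊕ Fin r) ((Fin m × Fin n) ⊕ Fin r) ℂ :=
  if (i : ℕ) = 0 then
    Matrix.fromBlocks (fiedlerP A i) (-blockCol m 0 S.C) (-blockRow m 0 S.B) (-S.A)
  else Matrix.fromBlocks (fiedlerP A i) 0 0 1

/-- The Fiedler matrix `𝕄^S_{-m}`. -/
def fiedlerSNeg {m n r : ℕ} (A : Fin (m + 1) → Matrix (Fin n) (Fin n) ℂ)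
    (S : Realization (Fin n) r) :
    Matrix ((Fin m × Fin n) ⊕ Fin r) ((Fin m × Fin n) ⊕ Fin r) ℂ :=
  Matrix.fromBlocks (fiedlerPNeg A) 0 0 (-S.E)

/-- The Fiedler pencil `λ M^P_{-m} - M^P_σ` of `P(λ)`; the permutation `σ` is read as the index
tuple `(σ 0, σ 1, …, σ (m-1))`, and `M^P_σ` is the product in this order. -/
def pencilP {m n : ℕ} (A : Fin (m + 1) → Matrix (Fin n) (Fin n) ℂ) (σ : Equiv.Perm (Fin m)) :
    Matrix (Fin m × Fin n) (Fin m × Fin n) ℂ[X] :=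
  (X : ℂ[X]) • const (fiedlerPNeg A) - const (List.ofFn fun k => fiedlerP A (σ k)).prod

/-- The Fiedler pencil `λ 𝕄^S_{-m} - 𝕄^S_σ`. -/
def pencilS {m n r : ℕ} (A : Fin (m + 1) → Matrix (Fin n) (Fin n) ℂ)
    (S : Realization (Fin n) r) (σ : Equiv.Perm (Fin m)) :
    Matrix ((Fin m × Fin n) ⊕ Fin r) ((Fin m × Fin n) ⊕ Fin r) ℂ[X] :=
  (X : ℂ[X]) • const (fiedlerSNeg A S) - const (List.ofFn fun k => fiedlerS A S (σ k)).prod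

/-! ### Consecutions and inversions -/

/-- The index tuple of a permutation of `{0, …, m-1}`. -/
def tuple {m : ℕ} (σ : Equiv.Perm (Fin m)) : List ℕ := List.ofFn fun k => (σ k : ℕ)

/-- `α` has `p` consecutive consecutions at `t`, i.e. `c_t(α) = p`: `(t, …, t+p)` is a subtuple
of `α` and `(t, …, t+p+1)` is not. -/
def HasConsecutions (α : List ℕ) (t p : ℕ) : Prop :=
  (List.range' t (p + 1)).Sublist α ∧ ¬ (List.range' t (p + 2)).Sublist α

/-- `α` has `s` consecutive inversions at `t`, i.e. `i_t(α) = s`: `(t+s, …, t)` is a subtuple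
of `α` and `(t+s+1, …, t)` is not. -/
def HasInversions (α : List ℕ) (t s : ℕ) : Prop :=
  (List.range' t (s + 1)).reverse.Sublist α ∧ ¬ (List.range' t (s + 2)).reverse.Sublist α

end

end Fiedler

namespace Fiedler

noncomputable section

/-! ### Elementary matrices over a commutative ring -/

section Generic

set_option linter.unusedSectionVars false

variable {R : Type*} [CommRing R]

/-! Everything rests on one reduction, done over an arbitrary commutative ring `R` with a parameter
`t`. The Fiedler matrix of largest index `m-1` commutes with every other one except that of index
`m-2`. It can therefore be moved to one end of the product, and what remains is `diag(I, M)` with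
`M` a Fiedler product of `m-1` blocks (`genProd_split`). A block elimination then turns `t diag(K,
I) - M_σ` into `diag(I, t diag(tK + A_{m-1}, I) - M)`, which is one step of Horner's scheme on the
leading coefficient. Iterating gives `diag(I, P)` (`exists_pencil_equiv`). For `R = ℂ[X]` and `t =
X` the transformations `U`, `V` are unimodular.

The eliminating matrices do not depend on the constant term `Z = -A_0`, and `M_σ` is affine in `Z`.
Comparing coefficients of `Z` shows how `U` and `V` act on the block column and block row that
multiply `Z`. After a harmless correction they carry them exactly to `e_m ⊗ I` and `e_m^T ⊗ I`
(`exists_pencil_equiv_normalized`). The system pencil is bordered by precisely this column times `C`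
and `B` times this row, so the same `U`, `V` bring it to `diag(I, S(λ))`, with `U_0 = V_0 = I`.
Tracking unit columns through the product places the border in blocks `m - i_0(σ)` and `m - c_0(σ)`.

Irreducibility: the normalization writes `G` as a polynomial two-sided multiple of the pencil's
transfer function. Division by the regular pencil of any realization, with constant remainder,
yields a realization of such a multiple of the same size (`exists_realization_mul`). Hence a smaller
realization of the pencil's transfer function would give one of `G`.

At infinity, `C(λE - A)⁻¹B` is proper and enters the pencil's transfer function only by being added
to `A_0`. So `λ⁻¹` times that function is a reversed Fiedler pencil over the ring of proper rational
functions, with `t = λ⁻¹`. A similar elimination (`exists_reversal_equiv`) reduces it to `diag(I,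
λ^{-m} G)`. Matrices with unit determinant over that ring are biproper. -/

/-- The matrix `diag([-a, I; I, 0], I)`. -/
def topBlock {ν κ : Type*} [DecidableEq ν] [DecidableEq κ] (a : Matrix ν ν R) :
    Matrix (ν ⊕ (ν ⊕ κ)) (ν ⊕ (ν ⊕ κ)) R :=
  Matrix.fromBlocks (-a) (Matrix.fromCols 1 0) (Matrix.fromRows 1 0) (Matrix.fromBlocks 0 0 0 1)

theorem isUnit_det_transpose {ι : Type*} [Fintype ι] [DecidableEq ι] {U : Matrix ι ι R}
    (h : IsUnit U.det) : IsUnit U.transpose.det := by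
  rwa [Matrix.det_transpose]

theorem isUnit_det_mul {ι : Type*} [Fintype ι] [DecidableEq ι] {U V : Matrix ι ι R}
    (hU : IsUnit U.det) (hV : IsUnit V.det) : IsUnit (U * V).det := by
  rw [Matrix.det_mul]; exact hU.mul hV

variable {ν κ : Type*} [Fintype ν] [Fintype κ] [DecidableEq ν] [DecidableEq κ]

theorem topBlock_transpose (a : Matrix ν ν R) :
    (topBlock (κ := κ) a).transpose = topBlock a.transpose := by
  simp [topBlock, Matrix.fromBlocks_transpose, Matrix.transpose_fromCols,
    Matrix.transpose_fromRows]

/-- The inverse of `topBlock a`. -/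
def topBlockInv (a : Matrix ν ν R) : Matrix (ν ⊕ (ν ⊕ κ)) (ν ⊕ (ν ⊕ κ)) R :=
  Matrix.fromBlocks 0 (Matrix.fromCols 1 0) (Matrix.fromRows 1 0) (Matrix.fromBlocks a 0 0 1)

theorem topBlockInv_mul (a : Matrix ν ν R) : topBlockInv (κ := κ) a * topBlock a = 1 := by
  rw [topBlockInv, topBlock, Matrix.fromBlocks_multiply]
  simp [Matrix.fromCols_mul_fromRows, Matrix.fromRows_mul, Matrix.mul_fromCols,
    Matrix.fromBlocks_multiply, Matrix.fromBlocks_mul_fromRows,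
    Matrix.fromCols_mul_fromBlocks]
  ext (_ | _ | _) (_ | _ | _) <;> simp [Matrix.one_apply]

theorem isUnit_det_topBlockInv (a : Matrix ν ν R) : IsUnit (topBlockInv (κ := κ) a).det :=
  IsUnit.of_mul_eq_one (topBlock a).det (by rw [← Matrix.det_mul, topBlockInv_mul, Matrix.det_one])

/-- Multiplying by `topBlockInv a` puts the pivot `-1` in the first block and confines `M` to the
last one. The Schur complement contributes `t²K` to the corner. Since the pivot row and column are
free of `M`, so are `U` and `V`; this order of quantifiers is needed later to vary the constant
coefficient. -/
theorem pencil_step_left_blocks (t : R) (K a : Matrix ν ν R) :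
    ∃ U V : Matrix (ν ⊕ (ν ⊕ κ)) (ν ⊕ (ν ⊕ κ)) R, IsUnit U.det ∧ IsUnit V.det ∧
      ∀ M : Matrix (ν ⊕ κ) (ν ⊕ κ) R,
        U * (t • Matrix.fromBlocks K 0 0 1 - topBlock a * Matrix.fromBlocks 1 0 0 M) * V
          = Matrix.fromBlocks 1 0 0 (t • Matrix.fromBlocks (t • K + a) 0 0 1 - M) := by
  refine ⟨Matrix.fromBlocks (-1) 0 (t • Matrix.fromRows K 0) 1 * topBlockInv a,
    Matrix.fromBlocks 1 (t • Matrix.fromCols 1 0) 0 1, ?_, ?_, fun M => ?_⟩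
  · refine isUnit_det_mul ?_ (isUnit_det_topBlockInv a)
    rw [Matrix.det_fromBlocks_zero₁₂, Matrix.det_neg]
    simpa using (isUnit_one.neg).pow _
  · rw [Matrix.det_fromBlocks_zero₂₁]
    simp
  · have h1 : topBlockInv a *
        (t • Matrix.fromBlocks K 0 0 1 - topBlock a * Matrix.fromBlocks 1 0 0 M)
        = Matrix.fromBlocks (-1) (t • Matrix.fromCols 1 0) (t • Matrix.fromRows K 0)
          (t • Matrix.fromBlocks a 0 0 1 - M) := by
      rw [mul_sub, ← mul_assoc, topBlockInv_mul, one_mul, mul_smul_comm, topBlockInv,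
        Matrix.fromBlocks_multiply, Matrix.fromBlocks_smul, sub_eq_add_neg, Matrix.fromBlocks_neg,
        Matrix.fromBlocks_add]
      simp [Matrix.fromRows_mul, sub_eq_add_neg]
    rw [mul_assoc (Matrix.fromBlocks _ _ _ _), h1, Matrix.fromBlocks_multiply,
      Matrix.fromBlocks_multiply]
    congr 1
    · simp
    · ext i (j | j) <;> simp
    · simp
    · simp only [Matrix.zero_mul, Matrix.one_mul, Matrix.mul_one, Matrix.smul_mul, Matrix.mul_smul,
        Matrix.fromRows_mul_fromCols, Matrix.mul_zero, smul_zero,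
        Matrix.mul_neg, neg_add_cancel]
      have h2 : Matrix.fromBlocks (t • K + a) 0 0 (1 : Matrix κ κ R)
          = t • Matrix.fromBlocks K 0 0 0 + Matrix.fromBlocks a 0 0 1 := by
        simp [Matrix.fromBlocks_smul, Matrix.fromBlocks_add]
      rw [h2, smul_add]
      abel

theorem pencil_step_right_blocks (t : R) (K a : Matrix ν ν R) :
    ∃ U V : Matrix (ν ⊕ (ν ⊕ κ)) (ν ⊕ (ν ⊕ κ)) R, IsUnit U.det ∧ IsUnit V.det ∧
      ∀ M : Matrix (ν ⊕ κ) (ν ⊕ κ) R,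
        U * (t • Matrix.fromBlocks K 0 0 1 - Matrix.fromBlocks 1 0 0 M * topBlock a) * V
          = Matrix.fromBlocks 1 0 0 (t • Matrix.fromBlocks (t • K + a) 0 0 1 - M) := by
  obtain ⟨U, V, hU, hV, h⟩ := pencil_step_left_blocks (κ := κ) t K.transpose a.transpose
  refine ⟨V.transpose, U.transpose, isUnit_det_transpose hV, isUnit_det_transpose hU, fun M => ?_⟩
  have := congrArg Matrix.transpose (h M.transpose)
  simpa [Matrix.transpose_mul, Matrix.fromBlocks_transpose, topBlock_transpose, mul_assoc]
    using this

/-- `diag(s I, I)`. -/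
def scaleTop (s : R) : Matrix (ν ⊕ κ) (ν ⊕ κ) R := Matrix.fromBlocks (s • 1) 0 0 1

/-- Elimination for the reversed pencil cannot avoid multiplying the first block column of `M` by
`t`. The scalings `s` and `u` are there to make the induction close: a step on the left replaces `u`
by `t * u`, one on the right replaces `s` by `t * s`. Unlike in the Horner step, the transformations
depend on `M`. -/
theorem reversal_step_left_blocks (t s u : R) (K a : Matrix ν ν R)
    (M : Matrix (ν ⊕ κ) (ν ⊕ κ) R) :
    ∃ U V : Matrix (ν ⊕ (ν ⊕ κ)) (ν ⊕ (ν ⊕ κ)) R, IsUnit U.det ∧ IsUnit V.det ∧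
      U * (Matrix.fromBlocks K 0 0 1
          - t • (scaleTop s * (topBlock a * Matrix.fromBlocks 1 0 0 M) * scaleTop u)) * V
        = Matrix.fromBlocks 1 0 0 (Matrix.fromBlocks (K + (t * (s * u)) • a) 0 0 1
          - t • (scaleTop s * M * scaleTop (t * u))) := by
  set p : Matrix ν (ν ⊕ κ) R := Matrix.fromCols 1 0 with hp
  set q : Matrix (ν ⊕ κ) ν R := Matrix.fromRows 1 0 with hq
  set d : Matrix (ν ⊕ κ) (ν ⊕ κ) R := Matrix.fromBlocks 0 0 0 1 with hd
  set k : Matrix ν ν R := K + (t * (s * u)) • a with hk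
  have hpq : p * q = 1 := by simp [hp, hq, Matrix.fromCols_mul_fromRows]
  have hpd : p * d = 0 := by simp [hp, hd, Matrix.fromCols_mul_fromBlocks]
  have hdq : d * q = 0 := by simp [hq, hd, Matrix.fromBlocks_mul_fromRows]
  have hdd : d * d = d := by simp [hd, Matrix.fromBlocks_multiply]
  have hS : ∀ c : R, (scaleTop c : Matrix (ν ⊕ κ) (ν ⊕ κ) R) = c • (q * p) + d := fun c => by
    rw [scaleTop, hp, hq, hd, Matrix.fromRows_mul_fromCols, Matrix.fromBlocks_smul,
      Matrix.fromBlocks_add]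
    simp
  have hqkp : Matrix.fromBlocks k 0 0 (1 : Matrix κ κ R) = q * k * p + d := by
    rw [hp, hq, hd, Matrix.fromRows_mul, Matrix.fromRows_mul_fromCols, Matrix.fromBlocks_add]
    simp
  have hQ : Matrix.fromBlocks K 0 0 1
      - t • (scaleTop s * (topBlock a * Matrix.fromBlocks 1 0 0 M) * scaleTop u)
      = Matrix.fromBlocks k (-(t * s) • (p * M)) (-(t * u) • q) (1 - t • (d * M)) := by
    rw [topBlock, ← hp, ← hq, ← hd, scaleTop, scaleTop, Matrix.fromBlocks_multiply,
      Matrix.fromBlocks_multiply, Matrix.fromBlocks_multiply, Matrix.fromBlocks_smul,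
      sub_eq_add_neg, Matrix.fromBlocks_neg, Matrix.fromBlocks_add]
    congr 1
    · simp [hk, smul_smul]; ring_nf
    · simp [smul_smul]
    · simp [smul_smul]
    · simp [sub_eq_add_neg]
  have hW : topBlockInv (κ := κ) (0 : Matrix ν ν R) = Matrix.fromBlocks 0 p q d := by
    simp [topBlockInv, hp, hq, hd]
  -- `topBlockInv 0` swaps the first two blocks. Applied on both sides, it brings an identity block
  -- to the pivot position.
  have hWQ : topBlockInv (κ := κ) (0 : Matrix ν ν R) *
      Matrix.fromBlocks k (-(t * s) • (p * M)) (-(t * u) • q) (1 - t • (d * M)) *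
      topBlockInv (κ := κ) (0 : Matrix ν ν R)
      = Matrix.fromBlocks 1 (-(t * u) • p) (-t • (scaleTop s * M * q))
        (q * k * p + d - t • (scaleTop s * M * d)) := by
    rw [hW, Matrix.fromBlocks_multiply, Matrix.fromBlocks_multiply]
    have e1 : p * (1 - t • (d * M)) = p := by
      rw [Matrix.mul_sub, Matrix.mul_smul, ← Matrix.mul_assoc, hpd]; simp
    have e2 : q * (-(t * s) • (p * M)) + d * (1 - t • (d * M)) = d - t • (scaleTop s * M) := by
      rw [hS, Matrix.mul_sub, Matrix.mul_smul, Matrix.mul_smul, ← Matrix.mul_assoc d d, hdd,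
        Matrix.add_mul, Matrix.smul_mul, smul_add, smul_smul, Matrix.mul_assoc q p M, neg_smul,
        Matrix.mul_one]
      abel
    have e3 : d * (-(t * u) • q) = 0 := by rw [Matrix.mul_smul, hdq, smul_zero]
    have e4 : p * (-(t * u) • q) = -(t * u) • 1 := by rw [Matrix.mul_smul, hpq]
    rw [e1, e2, e3, e4]
    congr 1
    · simp [hpq]
    · simp [hpd]
    · simp [Matrix.sub_mul, hdq]
    · simp only [Matrix.sub_mul, hdd, add_zero, Matrix.smul_mul]
      abel
  refine ⟨Matrix.fromBlocks 1 0 (t • (scaleTop s * M * q)) 1 * topBlockInv 0,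
    topBlockInv 0 * Matrix.fromBlocks 1 ((t * u) • p) 0 1,
    isUnit_det_mul ?_ (isUnit_det_topBlockInv 0), isUnit_det_mul (isUnit_det_topBlockInv 0) ?_, ?_⟩
  · rw [Matrix.det_fromBlocks_zero₁₂]; simp
  · rw [Matrix.det_fromBlocks_zero₂₁]; simp
  · rw [hQ]
    -- The Schur complement recombines because `d + (t * u) • (q * p)` is `scaleTop (t * u)`.
    have : ∀ a b c d e : Matrix (ν ⊕ (ν ⊕ κ)) (ν ⊕ (ν ⊕ κ)) R,
        a * b * c * (d * e) = a * (b * c * d) * e := fun a b c d e => by simp only [mul_assoc]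
    rw [this, hWQ, Matrix.fromBlocks_multiply, Matrix.fromBlocks_multiply, hqkp, hS (t * u)]
    congr 1
    · simp
    · simp
    · simp
    · simp only [Matrix.mul_one, Matrix.one_mul, Matrix.mul_smul, Matrix.smul_mul, Matrix.mul_add,
        smul_add, smul_smul, Matrix.add_mul, neg_smul, Matrix.mul_neg, Matrix.neg_mul,
        Matrix.mul_assoc, smul_neg]
      rw [show t * u * t = t * (t * u) by ring]
      abel

theorem scaleTop_transpose (s : R) :
    (scaleTop s : Matrix (ν ⊕ κ) (ν ⊕ κ) R).transpose = scaleTop s := by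
  simp [scaleTop, Matrix.fromBlocks_transpose]

theorem reversal_step_right_blocks (t s u : R) (K a : Matrix ν ν R)
    (M : Matrix (ν ⊕ κ) (ν ⊕ κ) R) :
    ∃ U V : Matrix (ν ⊕ (ν ⊕ κ)) (ν ⊕ (ν ⊕ κ)) R, IsUnit U.det ∧ IsUnit V.det ∧
      U * (Matrix.fromBlocks K 0 0 1
          - t • (scaleTop s * (Matrix.fromBlocks 1 0 0 M * topBlock a) * scaleTop u)) * V
        = Matrix.fromBlocks 1 0 0 (Matrix.fromBlocks (K + (t * (s * u)) • a) 0 0 1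
          - t • (scaleTop (t * s) * M * scaleTop u)) := by
  obtain ⟨U, V, hU, hV, h⟩ :=
    reversal_step_left_blocks (κ := κ) t u s K.transpose a.transpose M.transpose
  refine ⟨V.transpose, U.transpose, isUnit_det_transpose hV, isUnit_det_transpose hU, ?_⟩
  have := congrArg Matrix.transpose h
  simpa [Matrix.transpose_mul, Matrix.fromBlocks_transpose, topBlock_transpose, mul_assoc,
    scaleTop_transpose, mul_comm u s] using this

end Generic

/-! ### Fiedler products over a commutative ring and removal of the largest index. -/

section Blocks

set_option linter.unusedSectionVars false

variable {R : Type*} [CommRing R] {n : ℕ}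

/-- The elementary matrix `M_i(Y)`, `i ≥ 1`, over a commutative ring. -/
def genPos (m i : ℕ) (Y : Matrix (Fin n) (Fin n) R) :
    Matrix (Fin m × Fin n) (Fin m × Fin n) R :=
  Matrix.comp (Fin m) (Fin m) (Fin n) (Fin n) R <| Matrix.of fun p q =>
    if (p : ℕ) + i + 1 = m ∧ (q : ℕ) + i + 1 = m then Y
    else if (p : ℕ) + i + 1 = m ∧ (q : ℕ) + i = m then 1
    else if (p : ℕ) + i = m ∧ (q : ℕ) + i + 1 = m then 1
    else if (p : ℕ) + i = m ∧ (q : ℕ) + i = m then 0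
    else if p = q then 1 else 0

/-- The matrix `diag(Y, I_{(m-1)n})` over a commutative ring. -/
def genNegTop (m : ℕ) (Y : Matrix (Fin n) (Fin n) R) :
    Matrix (Fin m × Fin n) (Fin m × Fin n) R :=
  Matrix.comp (Fin m) (Fin m) (Fin n) (Fin n) R <| Matrix.of fun p q =>
    if p = q then (if (p : ℕ) = 0 then Y else 1) else 0

/-- The Fiedler matrix with index `i`, with `Z` in place of `-A_0`. -/
def genFiedler (m : ℕ) (Z : Matrix (Fin n) (Fin n) R) (A : ℕ → Matrix (Fin n) (Fin n) R) (i : ℕ) :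
    Matrix (Fin m × Fin n) (Fin m × Fin n) R :=
  if i = 0 then elemZero m Z else genPos m i (-A i)

/-- The product of the Fiedler matrices with indices in a list. -/
def genProd (m : ℕ) (Z : Matrix (Fin n) (Fin n) R) (A : ℕ → Matrix (Fin n) (Fin n) R)
    (l : List ℕ) : Matrix (Fin m × Fin n) (Fin m × Fin n) R :=
  (l.map (genFiedler m Z A)).prod

/-- Separates the first block from the others. -/
def splitFirst (k n : ℕ) : Fin (k + 1) × Fin n ≃ Fin n ⊕ (Fin k × Fin n) where
  toFun p := Fin.cases (Sum.inl p.2) (fun i => Sum.inr (i, p.2)) p.1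
  invFun := Sum.elim (fun a => (0, a)) (fun q => (q.1.succ, q.2))
  left_inv := by
    rintro ⟨p, a⟩
    refine Fin.cases ?_ (fun i => ?_) p <;> simp
  right_inv := by
    rintro (a | ⟨q, a⟩) <;> simp

/-- Separates the first two blocks from the others. -/
def splitTwo (k n : ℕ) : Fin (k + 2) × Fin n ≃ Fin n ⊕ (Fin n ⊕ (Fin k × Fin n)) :=
  (splitFirst (k + 1) n).trans (Equiv.sumCongr (Equiv.refl _) (splitFirst k n))

@[simp] theorem splitFirst_zero (k : ℕ) (a : Fin n) : splitFirst k n (0, a) = Sum.inl a := rfl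

@[simp] theorem splitFirst_succ (k : ℕ) (i : Fin k) (a : Fin n) :
    splitFirst k n (i.succ, a) = Sum.inr (i, a) := rfl

@[simp] theorem splitFirst_one (k : ℕ) (a : Fin n) :
    splitFirst (k + 1) n (1, a) = Sum.inr (0, a) := rfl

/-- `diag(I_n, M)`. -/
def embed {k : ℕ} (M : Matrix (Fin k × Fin n) (Fin k × Fin n) R) :
    Matrix (Fin (k + 1) × Fin n) (Fin (k + 1) × Fin n) R :=
  (Matrix.fromBlocks 1 0 0 M).submatrix (splitFirst k n) (splitFirst k n)

theorem embed_mul {k : ℕ} (M N : Matrix (Fin k × Fin n) (Fin k × Fin n) R) :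
    embed (M * N) = embed M * embed N := by
  simp [embed, Matrix.submatrix_mul_equiv, Matrix.fromBlocks_multiply]

theorem embed_one {k : ℕ} : embed (1 : Matrix (Fin k × Fin n) (Fin k × Fin n) R) = 1 := by
  simp [embed, Matrix.fromBlocks_one]

theorem det_embed {k : ℕ} (M : Matrix (Fin k × Fin n) (Fin k × Fin n) R) :
    (embed M).det = M.det := by
  simp [embed, Matrix.det_submatrix_equiv_self]

theorem genNegTop_succ (k : ℕ) (Y : Matrix (Fin n) (Fin n) R) :
    genNegTop (k + 1) Y
      = (Matrix.fromBlocks Y 0 0 1).submatrix (splitFirst k n) (splitFirst k n) := by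
  ext ⟨p, a⟩ ⟨q, b⟩
  refine Fin.cases ?_ (fun p => ?_) p <;> refine Fin.cases ?_ (fun q => ?_) q
  · simp [genNegTop]
  · simp [genNegTop, (Fin.succ_ne_zero q).symm]
  · simp [genNegTop]
  · by_cases h : p = q <;> simp [genNegTop, h, Matrix.one_apply]

theorem genNegTop_succ_succ (k : ℕ) (Y : Matrix (Fin n) (Fin n) R) :
    genNegTop (k + 2) Y
      = (Matrix.fromBlocks Y 0 0 1).submatrix (splitTwo k n) (splitTwo k n) := by
  rw [genNegTop_succ]
  ext ⟨p, a⟩ ⟨q, b⟩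
  refine Fin.cases ?_ (fun p => ?_) p <;> refine Fin.cases ?_ (fun q => ?_) q <;>
    simp [splitTwo, Matrix.one_apply]

theorem elemZero_succ (k : ℕ) (Y : Matrix (Fin n) (Fin n) R) :
    elemZero (k + 2) Y = embed (elemZero (k + 1) Y) := by
  ext ⟨p, a⟩ ⟨q, b⟩
  refine Fin.cases ?_ (fun p => ?_) p <;> refine Fin.cases ?_ (fun q => ?_) q
  · simp [elemZero, embed]
  · simp [elemZero, embed, (Fin.succ_ne_zero q).symm]
  · simp [elemZero, embed]
  · by_cases h : p = q <;> simp [elemZero, embed, h]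

theorem genPos_succ (k i : ℕ) (hi : i < k) (Y : Matrix (Fin n) (Fin n) R) :
    genPos (k + 1) i Y = embed (genPos k i Y) := by
  ext ⟨p, a⟩ ⟨q, b⟩
  have e1 : ∀ x : ℕ, x + 1 + i + 1 = k + 1 ↔ x + i + 1 = k := fun x => by omega
  have e2 : ∀ x : ℕ, x + 1 + i = k + 1 ↔ x + i = k := fun x => by omega
  have e4 : ¬ (i = k + 1) := by omega
  have e5 : ¬ (i = k) := by omega
  refine Fin.cases ?_ (fun p => ?_) p <;> refine Fin.cases ?_ (fun q => ?_) q
  · simp [genPos, embed, e4, e5]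
  · simp [genPos, embed, e4, e5, (Fin.succ_ne_zero q).symm]
  · simp [genPos, embed, e4, e5]
  · simp only [genPos, embed, Matrix.comp_apply, Matrix.of_apply, Fin.val_succ, e1, e2,
      Matrix.submatrix_apply, splitFirst_succ, Matrix.fromBlocks_apply₂₂, Fin.succ_inj]

theorem genFiedler_succ (k i : ℕ) (hi : i < k + 1) (Z : Matrix (Fin n) (Fin n) R)
    (A : ℕ → Matrix (Fin n) (Fin n) R) :
    genFiedler (k + 2) Z A i = embed (genFiedler (k + 1) Z A i) := by
  unfold genFiedler
  split_ifs
  · exact elemZero_succ k Z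
  · exact genPos_succ (k + 1) i hi _

theorem genProd_succ (k : ℕ) (Z : Matrix (Fin n) (Fin n) R)
    (A : ℕ → Matrix (Fin n) (Fin n) R) (l : List ℕ) (hl : ∀ i ∈ l, i < k + 1) :
    genProd (k + 2) Z A l = embed (genProd (k + 1) Z A l) := by
  induction l with
  | nil => simp [genProd, embed_one]
  | cons a l ih =>
    simp only [genProd, List.map_cons, List.prod_cons, embed_mul] at ih ⊢
    rw [genFiedler_succ k a (hl a (by simp)), ih fun i hi => hl i (by simp [hi])]

theorem genPos_top (k : ℕ) (a : Matrix (Fin n) (Fin n) R) :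
    genPos (k + 2) (k + 1) (-a) = (topBlock a).submatrix (splitTwo k n) (splitTwo k n) := by
  ext ⟨p, x⟩ ⟨q, y⟩
  have e2 : ∀ x : ℕ, ¬ (x + 1 + 1 + (k + 1) = k + 2) := fun x => by omega
  have e3 : 1 + (k + 1) = k + 2 := by omega
  have e4 : ∀ i : Fin k, (1 : Fin (k + 2)) ≠ i.succ.succ := fun i h => by
    simpa using congrArg Fin.val h
  refine Fin.cases ?_ (fun p => ?_) p <;> refine Fin.cases ?_ (fun q => ?_) q
  · simp [genPos, topBlock, splitTwo]
  · refine Fin.cases ?_ (fun q => ?_) q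
    · simp [genPos, topBlock, splitTwo, e3]
    · simp [genPos, topBlock, splitTwo, e2, (Fin.succ_ne_zero _).symm]
  · refine Fin.cases ?_ (fun p => ?_) p
    · simp [genPos, topBlock, splitTwo, e3]
    · simp [genPos, topBlock, splitTwo, e2]
  · refine Fin.cases ?_ (fun p => ?_) p <;> refine Fin.cases ?_ (fun q => ?_) q
    · simp [genPos, topBlock, splitTwo, e3]
    · simp [genPos, topBlock, splitTwo, e2, e3, e4]
    · simp [genPos, topBlock, splitTwo, e2, e3, (e4 _).symm]
    · by_cases h : p = q <;> simp [genPos, topBlock, splitTwo, e2, Matrix.one_apply, h]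

theorem embed_eq_submatrix_splitTwo {k : ℕ}
    (M : Matrix (Fin (k + 1) × Fin n) (Fin (k + 1) × Fin n) R) :
    embed M = (Matrix.fromBlocks 1 0 0
      (M.submatrix (splitFirst k n).symm (splitFirst k n).symm)).submatrix
        (splitTwo k n) (splitTwo k n) := by
  ext ⟨p, x⟩ ⟨q, y⟩
  refine Fin.cases ?_ (fun p => ?_) p <;> refine Fin.cases ?_ (fun q => ?_) q <;>
    simp [splitTwo, embed]

theorem embed_submatrix_splitFirst {k : ℕ}
    (M : Matrix (Fin n ⊕ (Fin k × Fin n)) (Fin n ⊕ (Fin k × Fin n)) R) :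
    embed (M.submatrix (splitFirst k n) (splitFirst k n))
      = (Matrix.fromBlocks 1 0 0 M).submatrix (splitTwo k n) (splitTwo k n) := by
  rw [embed_eq_submatrix_splitTwo]
  simp [Matrix.submatrix_submatrix]

/-- The two factors act on complementary sets of blocks: the first two, and all the others. -/
theorem genPos_top_commute (k : ℕ) (a : Matrix (Fin n) (Fin n) R)
    (M : Matrix (Fin k × Fin n) (Fin k × Fin n) R) :
    Commute (genPos (k + 2) (k + 1) (-a)) (embed (embed M)) := by
  have h : embed (embed M) = (Matrix.fromBlocks 1 0 0 (Matrix.fromBlocks 1 0 0 M)).submatrix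
      (splitTwo k n) (splitTwo k n) := by
    rw [← embed_submatrix_splitFirst]; rfl
  rw [Commute, SemiconjBy, genPos_top, h, Matrix.submatrix_mul_equiv, Matrix.submatrix_mul_equiv]
  congr 1
  rw [topBlock, Matrix.fromBlocks_multiply, Matrix.fromBlocks_multiply]
  simp [Matrix.fromCols_mul_fromBlocks, Matrix.fromBlocks_mul_fromRows,
    Matrix.fromBlocks_multiply]

theorem genPos_top_commute_genFiedler (k i : ℕ) (hi : i < k) (a Z : Matrix (Fin n) (Fin n) R)
    (A : ℕ → Matrix (Fin n) (Fin n) R) :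
    Commute (genPos (k + 2) (k + 1) (-a)) (genFiedler (k + 2) Z A i) := by
  obtain ⟨j, rfl⟩ : ∃ j, k = j + 1 := ⟨k - 1, by omega⟩
  rw [genFiedler_succ _ i (by omega), genFiedler_succ _ i (by omega)]
  exact genPos_top_commute _ _ _

theorem genPos_top_commute_genProd (k : ℕ) (a Z : Matrix (Fin n) (Fin n) R)
    (A : ℕ → Matrix (Fin n) (Fin n) R) (l : List ℕ) (hl : ∀ i ∈ l, i < k) :
    Commute (genPos (k + 2) (k + 1) (-a)) (genProd (k + 2) Z A l) := by
  apply Commute.list_prod_right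
  intro M hM
  obtain ⟨i, hi, rfl⟩ := List.mem_map.1 hM
  exact genPos_top_commute_genFiedler k i (hl i hi) a Z A

theorem genProd_append (m : ℕ) (Z : Matrix (Fin n) (Fin n) R)
    (A : ℕ → Matrix (Fin n) (Fin n) R) (l₁ l₂ : List ℕ) :
    genProd m Z A (l₁ ++ l₂) = genProd m Z A l₁ * genProd m Z A l₂ := by
  simp [genProd]

/-- The Fiedler matrix with the largest index can be moved to one of the two ends. -/
theorem genProd_split (k : ℕ) (l : List ℕ) (hl : l.Perm (List.range (k + 2))) :
    ∃ l' : List ℕ, l'.Perm (List.range (k + 1)) ∧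
      ((∀ (Z : Matrix (Fin n) (Fin n) R) (A : ℕ → Matrix (Fin n) (Fin n) R),
        genProd (k + 2) Z A l
          = genPos (k + 2) (k + 1) (-A (k + 1)) * embed (genProd (k + 1) Z A l')) ∨
      (∀ (Z : Matrix (Fin n) (Fin n) R) (A : ℕ → Matrix (Fin n) (Fin n) R),
        genProd (k + 2) Z A l
          = embed (genProd (k + 1) Z A l') * genPos (k + 2) (k + 1) (-A (k + 1)))) := by
  have hmem : k + 1 ∈ l := hl.mem_iff.2 (by simp)
  obtain ⟨l₁, l₂, rfl⟩ := List.append_of_mem hmem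
  have hp : (l₁ ++ l₂).Perm (List.range (k + 1)) := by
    have h1 : ((k + 1) :: (l₁ ++ l₂)).Perm (l₁ ++ (k + 1) :: l₂) := List.perm_middle.symm
    have h2 : (List.range (k + 2)).Perm ((k + 1) :: List.range (k + 1)) := by
      rw [List.range_succ]
      exact List.perm_append_comm
    exact ((h1.trans hl).trans h2).cons_inv
  have hlt : ∀ i ∈ l₁ ++ l₂, i < k + 1 := fun i hi => List.mem_range.1 (hp.mem_iff.1 hi)
  have hnd : (l₁ ++ l₂).Nodup := hp.nodup_iff.2 List.nodup_range
  have hk : k ∈ l₁ ++ l₂ := hp.mem_iff.2 (by simp)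
  have htop : ∀ (Z : Matrix (Fin n) (Fin n) R) (A : ℕ → Matrix (Fin n) (Fin n) R),
      genProd (k + 2) Z A (l₁ ++ (k + 1) :: l₂) = genProd (k + 2) Z A l₁ *
        (genPos (k + 2) (k + 1) (-A (k + 1)) * genProd (k + 2) Z A l₂) := fun Z A => by
    rw [genProd_append]
    simp [genProd, genFiedler]
  refine ⟨l₁ ++ l₂, hp, ?_⟩
  -- Index `k` is the only obstruction to commuting, so the top factor moves to the end away from
  -- it.
  rcases List.mem_append.1 hk with h | h
  · right
    intro Z A
    have hk2 : k ∉ l₂ := fun h2 => (List.disjoint_of_nodup_append hnd) h h2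
    have hc := genPos_top_commute_genProd k (A (k + 1)) Z A l₂ fun i hi => by
      have := hlt i (by simp [hi])
      have : i ≠ k := fun h' => hk2 (h' ▸ hi)
      omega
    rw [htop, hc.eq, ← mul_assoc, ← genProd_append, genProd_succ k Z A _ hlt]
  · left
    intro Z A
    have hk1 : k ∉ l₁ := fun h2 => (List.disjoint_of_nodup_append hnd) h2 h
    have hc := genPos_top_commute_genProd k (A (k + 1)) Z A l₁ fun i hi => by
      have := hlt i (by simp [hi])
      have : i ≠ k := fun h' => hk1 (h' ▸ hi)
      omega
    rw [htop, ← mul_assoc, ← hc.eq, mul_assoc, ← genProd_append, genProd_succ k Z A _ hlt]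

end Blocks

/-! ### Iterated reduction of a Fiedler pencil and of its reversal. -/

section Equivalences

set_option linter.unusedSectionVars false

variable {R : Type*} [CommRing R] {n : ℕ}

theorem det_submatrix_splitTwo (k : ℕ)
    (U : Matrix (Fin n ⊕ (Fin n ⊕ (Fin k × Fin n))) (Fin n ⊕ (Fin n ⊕ (Fin k × Fin n))) R) :
    (U.submatrix (splitTwo k n) (splitTwo k n)).det = U.det :=
  Matrix.det_submatrix_equiv_self _ _

theorem smul_submatrix_sub {ι κ : Type*} (f : ι → κ) (t : R) (M N : Matrix κ κ R) :
    t • M.submatrix f f - N.submatrix f f = (t • M - N).submatrix f f := rfl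

theorem submatrix_sub_smul {ι κ : Type*} (f : ι → κ) (t : R) (M N : Matrix κ κ R) :
    M.submatrix f f - t • N.submatrix f f = (M - t • N).submatrix f f := rfl

theorem mul_submatrix_splitTwo_mul (k : ℕ)
    (U V Q : Matrix (Fin n ⊕ (Fin n ⊕ (Fin k × Fin n))) (Fin n ⊕ (Fin n ⊕ (Fin k × Fin n))) R) :
    U.submatrix (splitTwo k n) (splitTwo k n) * Q.submatrix (splitTwo k n) (splitTwo k n) *
      V.submatrix (splitTwo k n) (splitTwo k n)
      = (U * Q * V).submatrix (splitTwo k n) (splitTwo k n) := by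
  rw [Matrix.submatrix_mul_equiv, Matrix.submatrix_mul_equiv]

theorem pencil_step_left (k : ℕ) (t : R) (K a : Matrix (Fin n) (Fin n) R) :
    ∃ U V : Matrix (Fin (k + 2) × Fin n) (Fin (k + 2) × Fin n) R,
      IsUnit U.det ∧ IsUnit V.det ∧
      ∀ M : Matrix (Fin (k + 1) × Fin n) (Fin (k + 1) × Fin n) R,
        U * (t • genNegTop (k + 2) K - genPos (k + 2) (k + 1) (-a) * embed M) * V
          = embed (t • genNegTop (k + 1) (t • K + a) - M) := by
  obtain ⟨U, V, hU, hV, h⟩ := pencil_step_left_blocks (κ := Fin k × Fin n) t K a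
  refine ⟨U.submatrix (splitTwo k n) (splitTwo k n), V.submatrix (splitTwo k n) (splitTwo k n),
    by rwa [det_submatrix_splitTwo], by rwa [det_submatrix_splitTwo], fun M => ?_⟩
  have h' := congrArg (fun N => N.submatrix (splitTwo k n) (splitTwo k n))
    (h (M.submatrix (splitFirst k n).symm (splitFirst k n).symm))
  simp only [← embed_submatrix_splitFirst] at h'
  rw [genNegTop_succ_succ, genPos_top, embed_eq_submatrix_splitTwo M,
    Matrix.submatrix_mul_equiv, smul_submatrix_sub, mul_submatrix_splitTwo_mul, h',
    genNegTop_succ]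
  congr 1
  ext i j
  simp

theorem pencil_step_right (k : ℕ) (t : R) (K a : Matrix (Fin n) (Fin n) R) :
    ∃ U V : Matrix (Fin (k + 2) × Fin n) (Fin (k + 2) × Fin n) R,
      IsUnit U.det ∧ IsUnit V.det ∧
      ∀ M : Matrix (Fin (k + 1) × Fin n) (Fin (k + 1) × Fin n) R,
        U * (t • genNegTop (k + 2) K - embed M * genPos (k + 2) (k + 1) (-a)) * V
          = embed (t • genNegTop (k + 1) (t • K + a) - M) := by
  obtain ⟨U, V, hU, hV, h⟩ := pencil_step_right_blocks (κ := Fin k × Fin n) t K a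
  refine ⟨U.submatrix (splitTwo k n) (splitTwo k n), V.submatrix (splitTwo k n) (splitTwo k n),
    by rwa [det_submatrix_splitTwo], by rwa [det_submatrix_splitTwo], fun M => ?_⟩
  have h' := congrArg (fun N => N.submatrix (splitTwo k n) (splitTwo k n))
    (h (M.submatrix (splitFirst k n).symm (splitFirst k n).symm))
  simp only [← embed_submatrix_splitFirst] at h'
  rw [genNegTop_succ_succ, genPos_top, embed_eq_submatrix_splitTwo M,
    Matrix.submatrix_mul_equiv, smul_submatrix_sub, mul_submatrix_splitTwo_mul, h',
    genNegTop_succ]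
  congr 1
  ext i j
  simp

theorem submatrix_scaleTop_mul (k : ℕ) (s u : R)
    (M : Matrix (Fin (k + 1) × Fin n) (Fin (k + 1) × Fin n) R) :
    (scaleTop s * M.submatrix (splitFirst k n).symm (splitFirst k n).symm * scaleTop u).submatrix
      (splitFirst k n) (splitFirst k n)
      = genNegTop (k + 1) (s • 1) * M * genNegTop (k + 1) (u • 1) := by
  rw [genNegTop_succ, genNegTop_succ, ← Matrix.submatrix_mul_equiv _ _ _ (splitFirst k n) _,
    ← Matrix.submatrix_mul_equiv _ _ _ (splitFirst k n) _]
  simp [scaleTop, Matrix.submatrix_submatrix]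

theorem reversal_step_left (k : ℕ) (t s u : R) (K a : Matrix (Fin n) (Fin n) R)
    (M : Matrix (Fin (k + 1) × Fin n) (Fin (k + 1) × Fin n) R) :
    ∃ U V : Matrix (Fin (k + 2) × Fin n) (Fin (k + 2) × Fin n) R,
      IsUnit U.det ∧ IsUnit V.det ∧
      U * (genNegTop (k + 2) K - t • (genNegTop (k + 2) (s • 1) *
          (genPos (k + 2) (k + 1) (-a) * embed M) * genNegTop (k + 2) (u • 1))) * V
        = embed (genNegTop (k + 1) (K + (t * (s * u)) • a)
          - t • (genNegTop (k + 1) (s • 1) * M * genNegTop (k + 1) ((t * u) • 1))) := by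
  obtain ⟨U, V, hU, hV, h⟩ := reversal_step_left_blocks (κ := Fin k × Fin n) t s u K a
    (M.submatrix (splitFirst k n).symm (splitFirst k n).symm)
  refine ⟨U.submatrix (splitTwo k n) (splitTwo k n), V.submatrix (splitTwo k n) (splitTwo k n),
    by rwa [det_submatrix_splitTwo], by rwa [det_submatrix_splitTwo], ?_⟩
  have h' := congrArg (fun N => N.submatrix (splitTwo k n) (splitTwo k n)) h
  simp only [← embed_submatrix_splitFirst] at h'
  rw [genNegTop_succ_succ, genNegTop_succ_succ, genNegTop_succ_succ, genPos_top,
    embed_eq_submatrix_splitTwo M, Matrix.submatrix_mul_equiv, mul_submatrix_splitTwo_mul,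
    submatrix_sub_smul, mul_submatrix_splitTwo_mul]
  rw [genNegTop_succ, ← submatrix_scaleTop_mul, submatrix_sub_smul]
  exact h'

theorem reversal_step_right (k : ℕ) (t s u : R) (K a : Matrix (Fin n) (Fin n) R)
    (M : Matrix (Fin (k + 1) × Fin n) (Fin (k + 1) × Fin n) R) :
    ∃ U V : Matrix (Fin (k + 2) × Fin n) (Fin (k + 2) × Fin n) R,
      IsUnit U.det ∧ IsUnit V.det ∧
      U * (genNegTop (k + 2) K - t • (genNegTop (k + 2) (s • 1) *
          (embed M * genPos (k + 2) (k + 1) (-a)) * genNegTop (k + 2) (u • 1))) * V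
        = embed (genNegTop (k + 1) (K + (t * (s * u)) • a)
          - t • (genNegTop (k + 1) ((t * s) • 1) * M * genNegTop (k + 1) (u • 1))) := by
  obtain ⟨U, V, hU, hV, h⟩ := reversal_step_right_blocks (κ := Fin k × Fin n) t s u K a
    (M.submatrix (splitFirst k n).symm (splitFirst k n).symm)
  refine ⟨U.submatrix (splitTwo k n) (splitTwo k n), V.submatrix (splitTwo k n) (splitTwo k n),
    by rwa [det_submatrix_splitTwo], by rwa [det_submatrix_splitTwo], ?_⟩
  have h' := congrArg (fun N => N.submatrix (splitTwo k n) (splitTwo k n)) h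
  simp only [← embed_submatrix_splitFirst] at h'
  rw [genNegTop_succ_succ, genNegTop_succ_succ, genNegTop_succ_succ, genPos_top,
    embed_eq_submatrix_splitTwo M, Matrix.submatrix_mul_equiv, mul_submatrix_splitTwo_mul,
    submatrix_sub_smul, mul_submatrix_splitTwo_mul]
  rw [genNegTop_succ, ← submatrix_scaleTop_mul, submatrix_sub_smul]
  exact h'

theorem genProd_one (Z : Matrix (Fin n) (Fin n) R) (A : ℕ → Matrix (Fin n) (Fin n) R)
    (l : List ℕ) (hl : l.Perm (List.range 1)) : genProd 1 Z A l = elemZero 1 Z := by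
  obtain rfl : l = [0] := by simpa using hl
  simp [genProd, genFiedler]

theorem genNegTop_one (K : Matrix (Fin n) (Fin n) R) : genNegTop 1 K = elemZero 1 K := by
  ext ⟨p, a⟩ ⟨q, b⟩
  simp [genNegTop, elemZero, Subsingleton.elim p q]

theorem elemZero_one_apply (K : Matrix (Fin n) (Fin n) R) (p q : Fin 1 × Fin n) :
    elemZero 1 K p q = K p.2 q.2 := by
  simp [elemZero, Subsingleton.elim p.1 q.1]

theorem elemZero_mul (k : ℕ) (Y Y' : Matrix (Fin n) (Fin n) R) :
    elemZero (k + 1) Y * elemZero (k + 1) Y' = elemZero (k + 1) (Y * Y') := by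
  induction k with
  | zero =>
    ext p q
    simp [elemZero_one_apply, Matrix.mul_apply, Fintype.sum_prod_type]
  | succ k ih => rw [elemZero_succ, elemZero_succ, elemZero_succ, ← embed_mul, ih]

theorem elemZero_id (k : ℕ) : elemZero (k + 1) (1 : Matrix (Fin n) (Fin n) R) = 1 := by
  induction k with
  | zero =>
    ext ⟨p, a⟩ ⟨q, b⟩
    obtain rfl : p = q := Subsingleton.elim (α := Fin 1) p q
    simp [elemZero_one_apply, Matrix.one_apply]
  | succ k ih => rw [elemZero_succ, ih, embed_one]

/-- A Fiedler pencil is unimodularly equivalent to `diag(I, P)`, with transformations which do not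
depend on the coefficient of order zero. -/
theorem exists_pencil_equiv (k : ℕ) (t : R) (A : ℕ → Matrix (Fin n) (Fin n) R) (l : List ℕ)
    (hl : l.Perm (List.range (k + 1))) (K : Matrix (Fin n) (Fin n) R) :
    ∃ U V : Matrix (Fin (k + 1) × Fin n) (Fin (k + 1) × Fin n) R,
      IsUnit U.det ∧ IsUnit V.det ∧ ∀ Z : Matrix (Fin n) (Fin n) R,
        U * (t • genNegTop (k + 1) K - genProd (k + 1) Z A l) * V
          = elemZero (k + 1)
            (t ^ (k + 1) • K + ∑ j ∈ Finset.range k, t ^ (j + 1) • A (j + 1) - Z) := by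
  induction k generalizing l K with
  | zero =>
    -- With a single block the first and last blocks coincide, and the pencil is already `t • K -
    -- Z`.
    refine ⟨1, 1, by simp, by simp, fun Z => ?_⟩
    rw [genProd_one Z A l hl, genNegTop_one]
    ext p q
    simp [elemZero_one_apply]
  | succ k ih =>
    obtain ⟨l', hl', h⟩ := genProd_split (R := R) (n := n) k l hl
    -- Horner's scheme: the shorter pencil has leading coefficient `t • K + A (k + 1)`.
    obtain ⟨U, V, hU, hV, hUV⟩ := ih l' hl' (t • K + A (k + 1))
    have hsum : ∀ Z, t ^ (k + 1) • (t • K + A (k + 1))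
        + ∑ j ∈ Finset.range k, t ^ (j + 1) • A (j + 1) - Z
        = t ^ (k + 1 + 1) • K + ∑ j ∈ Finset.range (k + 1), t ^ (j + 1) • A (j + 1) - Z :=
      fun Z => by
        rw [Finset.sum_range_succ, smul_add, smul_smul, ← pow_succ]
        abel
    have hassoc : ∀ a b c d e : Matrix (Fin (k + 2) × Fin n) (Fin (k + 2) × Fin n) R,
        a * b * c * (d * e) = a * (b * c * d) * e := fun a b c d e => by simp only [mul_assoc]
    rcases h with h | h
    · obtain ⟨U', V', hU', hV', h'⟩ := pencil_step_left k t K (A (k + 1))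
      refine ⟨embed U * U', V' * embed V, isUnit_det_mul (by rwa [det_embed]) hU',
        isUnit_det_mul hV' (by rwa [det_embed]), fun Z => ?_⟩
      rw [h Z A, hassoc, h', ← embed_mul, ← embed_mul, hUV, ← elemZero_succ, hsum]
    · obtain ⟨U', V', hU', hV', h'⟩ := pencil_step_right k t K (A (k + 1))
      refine ⟨embed U * U', V' * embed V, isUnit_det_mul (by rwa [det_embed]) hU',
        isUnit_det_mul hV' (by rwa [det_embed]), fun Z => ?_⟩
      rw [h Z A, hassoc, h', ← embed_mul, ← embed_mul, hUV, ← elemZero_succ, hsum]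

/-- The reversal of a Fiedler pencil, with its first block row and column scaled by `s` and `u`,
is unimodularly equivalent to `diag(I, Q)`, where `Q` is the reversal of `P` up to scaling. -/
theorem exists_reversal_equiv (k : ℕ) (t s u : R) (A : ℕ → Matrix (Fin n) (Fin n) R) (l : List ℕ)
    (hl : l.Perm (List.range (k + 1))) (K Z : Matrix (Fin n) (Fin n) R) :
    ∃ U V : Matrix (Fin (k + 1) × Fin n) (Fin (k + 1) × Fin n) R,
      IsUnit U.det ∧ IsUnit V.det ∧
        U * (genNegTop (k + 1) K - t • (genNegTop (k + 1) (s • 1) * genProd (k + 1) Z A l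
            * genNegTop (k + 1) (u • 1))) * V
          = elemZero (k + 1) (K + ∑ j ∈ Finset.range k, (t ^ (k - j) * (s * u)) • A (j + 1)
            - (t ^ (k + 1) * (s * u)) • Z) := by
  induction k generalizing l K s u with
  | zero =>
    refine ⟨1, 1, by simp, by simp, ?_⟩
    rw [genProd_one Z A l hl, genNegTop_one, genNegTop_one, genNegTop_one, elemZero_mul,
      elemZero_mul]
    ext p q
    simp [elemZero_one_apply]
    ring
  | succ k ih =>
    obtain ⟨l', hl', h⟩ := genProd_split (R := R) (n := n) k l hl
    -- `w` stands for the product of the two scalings after the step, which is `t * (s * u)`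
    -- whichever side absorbed the factor `t`.
    have hsum : ∀ w : R, w = t * (s * u) →
        K + (t * (s * u)) • A (k + 1) + ∑ j ∈ Finset.range k, (t ^ (k - j) * w) • A (j + 1)
          - (t ^ (k + 1) * w) • Z
        = K + ∑ j ∈ Finset.range (k + 1), (t ^ (k + 1 - j) * (s * u)) • A (j + 1)
          - (t ^ (k + 1 + 1) * (s * u)) • Z := by
      rintro w rfl
      rw [Finset.sum_range_succ]
      have : ∀ j ∈ Finset.range k, (t ^ (k + 1 - j) * (s * u)) • A (j + 1)
          = (t ^ (k - j) * (t * (s * u))) • A (j + 1) := fun j hj => by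
        rw [Nat.succ_sub (Finset.mem_range.1 hj).le, pow_succ, mul_assoc]
      rw [Finset.sum_congr rfl this, pow_succ t (k + 1), mul_assoc _ t]
      simp only [add_tsub_cancel_left, pow_one]
      abel
    have hassoc : ∀ a b c d e : Matrix (Fin (k + 2) × Fin n) (Fin (k + 2) × Fin n) R,
        a * b * c * (d * e) = a * (b * c * d) * e := fun a b c d e => by simp only [mul_assoc]
    rcases h with h | h
    · obtain ⟨U, V, hU, hV, hUV⟩ := ih s (t * u) l' hl' (K + (t * (s * u)) • A (k + 1))
      obtain ⟨U', V', hU', hV', h'⟩ :=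
        reversal_step_left k t s u K (A (k + 1)) (genProd (k + 1) Z A l')
      refine ⟨embed U * U', V' * embed V, isUnit_det_mul (by rwa [det_embed]) hU',
        isUnit_det_mul hV' (by rwa [det_embed]), ?_⟩
      rw [h Z A, hassoc, h', ← embed_mul, ← embed_mul, hUV, ← elemZero_succ, hsum _ (by ring)]
    · obtain ⟨U, V, hU, hV, hUV⟩ := ih (t * s) u l' hl' (K + (t * (s * u)) • A (k + 1))
      obtain ⟨U', V', hU', hV', h'⟩ :=
        reversal_step_right k t s u K (A (k + 1)) (genProd (k + 1) Z A l')
      refine ⟨embed U * U', V' * embed V, isUnit_det_mul (by rwa [det_embed]) hU',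
        isUnit_det_mul hV' (by rwa [det_embed]), ?_⟩
      rw [h Z A, hassoc, h', ← embed_mul, ← embed_mul, hUV, ← elemZero_succ, hsum _ (by ring)]

/-! ### The last block row and column -/

variable (R n) in
/-- The block column `e_{m-k} ⊗ I_n`. -/
def unitCol (m k : ℕ) : Matrix (Fin m × Fin n) (Fin n) R := blockCol m k 1

variable (R n) in
/-- The block row `e_{m-k}^T ⊗ I_n`. -/
def unitRow (m k : ℕ) : Matrix (Fin n) (Fin m × Fin n) R := blockRow m k 1

theorem blockCol_eq_mul (m k : ℕ) {r : ℕ} (Y : Matrix (Fin n) (Fin r) R) :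
    blockCol m k Y = unitCol R n m k * Y := by
  ext p b
  by_cases h : (p.1 : ℕ) + k + 1 = m <;>
    simp [unitCol, blockCol, Matrix.mul_apply, Matrix.one_apply, h]

theorem blockRow_eq_mul (m k : ℕ) {r : ℕ} (Y : Matrix (Fin r) (Fin n) R) :
    blockRow m k Y = Y * unitRow R n m k := by
  ext p b
  simp [unitRow, blockRow, Matrix.mul_apply, Matrix.one_apply]

theorem unitRow_mul_unitCol (k : ℕ) :
    unitRow R n (k + 1) 0 * unitCol R n (k + 1) 0 = 1 := by
  ext a b
  rw [Matrix.mul_apply, Fintype.sum_prod_type, Finset.sum_eq_single (Fin.last k)]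
  · simp [unitRow, unitCol, blockRow, blockCol, Matrix.one_apply]
  · intro q _ hq
    have : ¬ ((q : ℕ) = k) := fun h => hq (Fin.ext h)
    simp [unitRow, unitCol, blockRow, this]
  · simp

/-- This isolates the dependence on `Z`, making Fiedler products visibly affine in the constant
coefficient. -/
theorem elemZero_eq_add (k : ℕ) (Z : Matrix (Fin n) (Fin n) R) :
    elemZero (k + 1) Z
      = elemZero (k + 1) 0 + unitCol R n (k + 1) 0 * Z * unitRow R n (k + 1) 0 := by
  rw [← blockCol_eq_mul]
  ext ⟨p, a⟩ ⟨q, b⟩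
  simp only [elemZero, Matrix.comp_apply, Matrix.of_apply, Matrix.add_apply, Matrix.mul_apply,
    blockCol, unitRow, blockRow, Matrix.one_apply]
  by_cases h : p = q
  · subst h
    by_cases h2 : (p : ℕ) = k <;> simp [h2]
  · by_cases h2 : (p : ℕ) = k
    · have h3 : ¬ ((q : ℕ) = k) := fun h3 => h (Fin.ext (h2.trans h3.symm))
      simp [h, h3]
    · simp [h, h2]

theorem elemZero_mul_unitCol (k : ℕ) (Y : Matrix (Fin n) (Fin n) R) :
    elemZero (k + 1) Y * unitCol R n (k + 1) 0
      = unitCol R n (k + 1) 0 * Y := by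
  have h := elemZero_eq_add (R := R) (n := n) k 1
  have h0 : elemZero (k + 1) (0 : Matrix (Fin n) (Fin n) R) * unitCol R n (k + 1) 0 = 0 := by
    rw [elemZero_id] at h
    rw [← sub_eq_iff_eq_add.2 h, Matrix.sub_mul, Matrix.mul_one, Matrix.mul_assoc,
      unitRow_mul_unitCol, Matrix.one_mul, Matrix.mul_one, sub_self]
  rw [elemZero_eq_add, Matrix.add_mul, h0, Matrix.mul_assoc, unitRow_mul_unitCol,
    Matrix.mul_one, zero_add]

theorem unitRow_mul_elemZero (k : ℕ) (Y : Matrix (Fin n) (Fin n) R) :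
    unitRow R n (k + 1) 0 * elemZero (k + 1) Y
      = Y * unitRow R n (k + 1) 0 := by
  have h := elemZero_eq_add (R := R) (n := n) k 1
  have h0 : unitRow R n (k + 1) 0 * elemZero (k + 1) (0 : Matrix (Fin n) (Fin n) R) = 0 := by
    rw [elemZero_id] at h
    rw [← sub_eq_iff_eq_add.2 h, Matrix.mul_sub, Matrix.mul_one, Matrix.mul_one,
      ← Matrix.mul_assoc, unitRow_mul_unitCol, Matrix.one_mul, sub_self]
  rw [elemZero_eq_add, Matrix.mul_add, h0, Matrix.mul_assoc, ← Matrix.mul_assoc,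
    unitRow_mul_unitCol, Matrix.one_mul, zero_add]

theorem genProd_eq_of_notMem (m : ℕ) (Z Z' : Matrix (Fin n) (Fin n) R)
    (A : ℕ → Matrix (Fin n) (Fin n) R) (l : List ℕ) (hl : 0 ∉ l) :
    genProd m Z A l = genProd m Z' A l := by
  unfold genProd
  congr 1
  refine List.map_congr_left fun i hi => ?_
  have : i ≠ 0 := fun h => hl (h ▸ hi)
  simp [genFiedler, this]

theorem genProd_middle (m : ℕ) (Z : Matrix (Fin n) (Fin n) R)
    (A : ℕ → Matrix (Fin n) (Fin n) R) (l₁ l₂ : List ℕ) (h₁ : 0 ∉ l₁) (h₂ : 0 ∉ l₂) :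
    genProd m Z A (l₁ ++ 0 :: l₂) = genProd m 0 A l₁ * elemZero m Z * genProd m 0 A l₂ := by
  rw [genProd_append, genProd_eq_of_notMem m Z 0 A l₁ h₁, mul_assoc,
    ← genProd_eq_of_notMem m Z 0 A l₂ h₂]
  simp [genProd, genFiedler]

/-- `exists_pencil_equiv`, with transformations normalised on the block row and the block column
which multiply the coefficient of order zero. -/
theorem exists_pencil_equiv_normalized (k : ℕ) (t : R) (A : ℕ → Matrix (Fin n) (Fin n) R)
    (l₁ l₂ : List ℕ) (hl : (l₁ ++ 0 :: l₂).Perm (List.range (k + 1))) (h₁ : 0 ∉ l₁) (h₂ : 0 ∉ l₂)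
    (K : Matrix (Fin n) (Fin n) R) :
    ∃ U V : Matrix (Fin (k + 1) × Fin n) (Fin (k + 1) × Fin n) R,
      IsUnit U.det ∧ IsUnit V.det ∧ (∀ Z : Matrix (Fin n) (Fin n) R,
        U * (t • genNegTop (k + 1) K - genProd (k + 1) Z A (l₁ ++ 0 :: l₂)) * V
          = elemZero (k + 1)
            (t ^ (k + 1) • K + ∑ j ∈ Finset.range k, t ^ (j + 1) • A (j + 1) - Z)) ∧
      U * (genProd (k + 1) 0 A l₁ * unitCol R n (k + 1) 0) = unitCol R n (k + 1) 0 ∧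
      (unitRow R n (k + 1) 0 * genProd (k + 1) 0 A l₂) * V = unitRow R n (k + 1) 0 := by
  obtain ⟨U, V, hU, hV, h⟩ := exists_pencil_equiv k t A _ hl K
  set Q := t ^ (k + 1) • K + ∑ j ∈ Finset.range k, t ^ (j + 1) • A (j + 1) with hQ
  set e : Matrix (Fin (k + 1) × Fin n) (Fin n) R := unitCol R n (k + 1) 0 with he
  set f : Matrix (Fin n) (Fin (k + 1) × Fin n) R := unitRow R n (k + 1) 0 with hf
  have hfe : f * e = 1 := unitRow_mul_unitCol k
  set u := U * (genProd (k + 1) 0 A l₁ * e) with hu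
  set v := (f * genProd (k + 1) 0 A l₂) * V with hv
  -- Subtract the equivalence at `Z` from the one at `0`: the same `U`, `V` serve both, so only the
  -- terms linear in `Z` survive.
  have key : ∀ Z : Matrix (Fin n) (Fin n) R, u * Z * v = e * Z * f := fun Z => by
    have h1 := (h 0).symm
    have h2 := h Z
    rw [genProd_middle _ Z A l₁ l₂ h₁ h₂, elemZero_eq_add, elemZero_eq_add k (Q - Z)] at h2
    rw [genProd_middle _ 0 A l₁ l₂ h₁ h₂, elemZero_eq_add k (Q - 0)] at h1
    rw [← he, ← hf] at h1 h2
    have h3 : u * Z * v = U * (genProd (k + 1) 0 A l₁ * (e * Z * f) * genProd (k + 1) 0 A l₂) * V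
        := by
      simp only [hu, hv, Matrix.mul_assoc]
    rw [h3]
    simp only [Matrix.mul_add, Matrix.add_mul, Matrix.mul_sub, Matrix.sub_mul, sub_zero]
      at h1 h2 ⊢
    rw [← sub_eq_zero] at h1 h2 ⊢
    have h4 := congrArg₂ (· + ·) h1 h2
    simp only [add_zero] at h4
    rw [← neg_eq_zero, ← h4]
    abel
  -- From `u * Z * v = e * Z * f` it follows that `u = e * α` and `v = β * f`, with `α` and `β`
  -- mutually inverse and `β * Z * α = Z` for all `Z`.
  set α := f * u with hα
  set β := v * e with hβ
  have hact : ∀ Z : Matrix (Fin n) (Fin n) R, α * Z * β = Z := fun Z => by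
    calc α * Z * β = f * (u * Z * v) * e := by simp only [hα, hβ, Matrix.mul_assoc]
      _ = (f * e) * Z * (f * e) := by rw [key]; simp only [Matrix.mul_assoc]
      _ = Z := by rw [hfe, Matrix.one_mul, Matrix.mul_one]
  have hαβ : α * β = 1 := by simpa using hact 1
  have hβα : β * α = 1 := mul_eq_one_comm.1 hαβ
  have huβ : u * β = e := by
    have := congrArg (· * e) (key 1)
    simpa [Matrix.mul_assoc, hfe, hβ] using this
  have hαv : α * v = f := by
    have := congrArg (f * ·) (key 1)
    simpa [← Matrix.mul_assoc, hfe, hα] using this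
  have hu' : u = e * α := by rw [← huβ, Matrix.mul_assoc, hβα, Matrix.mul_one]
  have hv' : v = β * f := by rw [← hαv, ← Matrix.mul_assoc, hβα, Matrix.one_mul]
  have hact' : ∀ Z : Matrix (Fin n) (Fin n) R, β * Z * α = Z := fun Z => by
    conv_lhs => rw [← hact Z]
    calc β * (α * Z * β) * α = (β * α) * Z * (β * α) := by simp only [Matrix.mul_assoc]
      _ = Z := by rw [hβα, Matrix.one_mul, Matrix.mul_one]
  have hdet : (elemZero (k + 1) α).det * (elemZero (k + 1) β).det = 1 := by
    rw [← Matrix.det_mul, elemZero_mul, hαβ, elemZero_id, Matrix.det_one]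
  -- The correction by `diag(I, β)` and `diag(I, α)` cancels the stray factors of `u` and `v`. It
  -- fixes `diag(I, Q - Z)` because `β * (Q - Z) * α = Q - Z`.
  refine ⟨elemZero (k + 1) β * U, V * elemZero (k + 1) α,
    isUnit_det_mul (IsUnit.of_mul_eq_one _ ((mul_comm _ _).trans hdet)) hU,
    isUnit_det_mul hV (IsUnit.of_mul_eq_one _ hdet), fun Z => ?_, ?_, ?_⟩
  · rw [mul_assoc _ U, ← mul_assoc, mul_assoc _ _ V, h, elemZero_mul, elemZero_mul, hact']
  · rw [Matrix.mul_assoc, ← hu, hu', ← Matrix.mul_assoc, elemZero_mul_unitCol, ← he,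
      Matrix.mul_assoc, hβα, Matrix.mul_one]
  · rw [← Matrix.mul_assoc, ← hv, hv', Matrix.mul_assoc, unitRow_mul_elemZero, ← hf,
      ← Matrix.mul_assoc, hβα, Matrix.one_mul]

end Equivalences

/-! ### Transport of unit block columns and rows; consecutions and inversions at 0. -/

section Columns

variable {R : Type*} [CommRing R] {n : ℕ}

/-- Block column `m - k` of `M_a(Y)` is a unit column unless `a = k`, when it also contains `Y`. For
`a = k + 1` it is the second column `[I; 0]` of the nontrivial block, which moves the unit up by
one. -/
theorem genFiedler_mul_unitCol (m k a : ℕ) (hk : k < m) (ha0 : a ≠ 0) (hak : a ≠ k) (ham : a < m)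
    (Z : Matrix (Fin n) (Fin n) R) (A : ℕ → Matrix (Fin n) (Fin n) R) :
    genFiedler m Z A a * unitCol R n m k = unitCol R n m (if a = k + 1 then k + 1 else k) := by
  ext ⟨p, x⟩ y
  have hq0 : m - k - 1 < m := by omega
  rw [Matrix.mul_apply, Fintype.sum_prod_type, Finset.sum_eq_single ⟨m - k - 1, hq0⟩]
  · have e1 : m - k - 1 + k + 1 = m := by omega
    rw [Finset.sum_eq_single y]
    · simp only [genFiedler, ha0, if_false, genPos, Matrix.comp_apply, Matrix.of_apply, unitCol,
        blockCol, e1, if_true, Matrix.one_apply_eq, mul_one, Fin.ext_iff]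
      have := p.2
      split_ifs <;> first | rfl | omega
    · intro z _ hz
      simp [unitCol, blockCol, Matrix.one_apply_ne hz]
    · simp
  · intro q _ hq
    have : ¬ ((q : ℕ) + k + 1 = m) := fun h => hq (Fin.ext (by simp; omega))
    simp [unitCol, blockCol, this]
  · simp

/-- Reading a list of Fiedler indices from right to left: the largest `p` such that
`p, …, 2, 1` occur in this order. -/
def inversionCount (l : List ℕ) : ℕ := l.foldr (fun a k => if a = k + 1 then k + 1 else k) 0

theorem inversionCount_cons (a : ℕ) (l : List ℕ) :
    inversionCount (a :: l) = if a = inversionCount l + 1 then inversionCount l + 1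
      else inversionCount l := rfl

theorem inversionCount_mem (l : List ℕ) : inversionCount l ∈ 0 :: l := by
  induction l with
  | nil => simp [inversionCount]
  | cons a l ih =>
    rw [inversionCount_cons]
    split_ifs with h
    · simp [h]
    · simp only [List.mem_cons] at ih ⊢
      tauto

/-- Factors act from right to left. The forbidden case `a = k` never occurs: the current `k` is 0 or
an index already used, and the list has no repetition and no 0. -/
theorem genProd_mul_unitCol (m : ℕ) (hm : 0 < m) (l : List ℕ) (hl : ∀ a ∈ l, a < m) (h0 : 0 ∉ l)
    (hnd : l.Nodup) (Z : Matrix (Fin n) (Fin n) R) (A : ℕ → Matrix (Fin n) (Fin n) R) :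
    genProd m Z A l * unitCol R n m 0 = unitCol R n m (inversionCount l) := by
  induction l with
  | nil => simp [genProd, inversionCount]
  | cons a l ih =>
    have ih' := ih (fun b hb => hl b (by simp [hb])) (fun h => h0 (by simp [h])) hnd.of_cons
    have ha0 : a ≠ 0 := fun h => h0 (by simp [h])
    have hmem := inversionCount_mem l
    have hak : a ≠ inversionCount l := by
      rintro rfl
      rcases List.mem_cons.1 hmem with h | h
      · exact ha0 h
      · exact (List.nodup_cons.1 hnd).1 h
    have hk : inversionCount l < m := by
      rcases List.mem_cons.1 hmem with h | h
      · omega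
      · exact hl _ (by simp [h])
    rw [inversionCount_cons, ← genFiedler_mul_unitCol m _ a hk ha0 hak (hl a (by simp)) Z A, ← ih',
      ← Matrix.mul_assoc]
    simp [genProd]

theorem reverse_range'_succ (p : ℕ) :
    (List.range' 0 (p + 1)).reverse = p :: (List.range' 0 p).reverse := by
  rw [List.range'_concat]
  simp

theorem sublist_of_sublist_cons_of_ne {a b : ℕ} {s l : List ℕ} (hab : b ≠ a)
    (h : (b :: s).Sublist (a :: l)) : (b :: s).Sublist l := by
  rcases List.sublist_cons_iff.1 h with h | ⟨r, hr, _⟩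
  · exact h
  · exact absurd (List.cons.inj hr).1 hab

theorem reverse_range'_sublist_inversionCount (l : List ℕ) :
    (List.range' 0 (inversionCount l + 1)).reverse.Sublist (l ++ [0]) := by
  induction l with
  | nil => simp [inversionCount]
  | cons a l ih =>
    rw [inversionCount_cons]
    split_ifs with h
    · rw [reverse_range'_succ, h, List.cons_append]
      exact ih.cons_cons _
    · exact ih.cons _

/-- Scanning from the right greedily is optimal: as indices do not repeat, when `p + 1` has just
been counted, `p + 2` can only be found further left. -/
theorem not_reverse_range'_sublist_inversionCount (l : List ℕ) (h0 : 0 ∉ l) (hnd : l.Nodup) :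
    ¬ (List.range' 0 (inversionCount l + 2)).reverse.Sublist (l ++ [0]) := by
  induction l with
  | nil =>
    intro h
    have := h.length_le
    simp at this
  | cons a l ih =>
    have ih' := ih (fun h => h0 (by simp [h])) hnd.of_cons
    rw [inversionCount_cons]
    split_ifs with h
    · intro hs
      rw [reverse_range'_succ, List.cons_append] at hs
      have hs' := sublist_of_sublist_cons_of_ne (by omega) hs
      have : inversionCount l + 1 ∈ l ++ [0] :=
        hs'.subset (by rw [reverse_range'_succ]; simp)
      rw [List.mem_append, List.mem_singleton, ← h] at this
      rcases this with h' | h'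
      · exact (List.nodup_cons.1 hnd).1 h'
      · omega
    · intro hs
      rw [reverse_range'_succ, List.cons_append] at hs
      have hs' := sublist_of_sublist_cons_of_ne (Ne.symm h) hs
      rw [← reverse_range'_succ] at hs'
      exact ih' hs'

theorem concat_sublist_append {s l₁ l₂ : List ℕ} {a : ℕ} (ha : a ∉ l₂) :
    (s ++ [a]).Sublist (l₁ ++ l₂) ↔ (s ++ [a]).Sublist l₁ := by
  refine ⟨fun h => ?_, fun h => h.trans (List.sublist_append_left _ _)⟩
  obtain ⟨s₁, s₂, hs, h₁, h₂⟩ := List.sublist_append_iff.1 h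
  rcases List.eq_nil_or_concat s₂ with rfl | ⟨s₃, b, rfl⟩
  · rwa [hs, List.append_nil]
  · rw [List.concat_eq_append] at hs h₂
    rw [← List.append_assoc] at hs
    have : a = b := by simpa using (List.append_inj_right' hs rfl)
    exact absurd (h₂.subset (by simp [this])) ha

theorem reverse_range'_zero (p : ℕ) :
    ∃ s : List ℕ, (List.range' 0 (p + 1)).reverse = s ++ [0] :=
  ⟨(List.range' 1 p).reverse, by rw [List.range'_succ]; simp⟩

/-- A descending chain ends at the unique 0, so whatever follows 0 is irrelevant. -/
theorem hasInversions_middle (l₁ l₂ : List ℕ) (h₁ : 0 ∉ l₁) (h₂ : 0 ∉ l₂) (hnd : l₁.Nodup) :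
    HasInversions (l₁ ++ 0 :: l₂) 0 (inversionCount l₁) := by
  have e : ∀ p, (List.range' 0 (p + 1)).reverse.Sublist (l₁ ++ 0 :: l₂) ↔
      (List.range' 0 (p + 1)).reverse.Sublist (l₁ ++ [0]) := fun p => by
    obtain ⟨s, hs⟩ := reverse_range'_zero p
    rw [hs, show l₁ ++ 0 :: l₂ = (l₁ ++ [0]) ++ l₂ by simp]
    exact concat_sublist_append h₂
  exact ⟨(e _).2 (reverse_range'_sublist_inversionCount l₁),
    fun h => not_reverse_range'_sublist_inversionCount l₁ h₁ hnd ((e _).1 h)⟩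

/-- Reversing the tuple exchanges consecutions and inversions. -/
theorem hasConsecutions_middle (l₁ l₂ : List ℕ) (h₁ : 0 ∉ l₁) (h₂ : 0 ∉ l₂) (hnd : l₂.Nodup) :
    HasConsecutions (l₁ ++ 0 :: l₂) 0 (inversionCount l₂.reverse) := by
  have h := hasInversions_middle l₂.reverse l₁.reverse (by simpa) (by simpa)
    (List.nodup_reverse.2 hnd)
  have e : l₂.reverse ++ 0 :: l₁.reverse = (l₁ ++ 0 :: l₂).reverse := by simp
  rw [HasInversions, e, List.reverse_sublist, List.reverse_sublist] at h
  exact h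

theorem elemZero_transpose (m : ℕ) (Y : Matrix (Fin n) (Fin n) R) :
    (elemZero m Y).transpose = elemZero m Y.transpose := by
  ext ⟨p, a⟩ ⟨q, b⟩
  by_cases h : p = q
  · subst h
    simp only [elemZero, Matrix.transpose_apply, Matrix.comp_apply, Matrix.of_apply, if_true]
    split_ifs
    · rfl
    · simp [Matrix.one_apply, eq_comm]
  · simp [elemZero, h, Ne.symm h]

theorem genPos_transpose (m i : ℕ) (Y : Matrix (Fin n) (Fin n) R) :
    (genPos m i Y).transpose = genPos m i Y.transpose := by
  ext ⟨p, a⟩ ⟨q, b⟩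
  have h1 : ∀ x y : Fin n,
      (1 : Matrix (Fin n) (Fin n) R) x y = (1 : Matrix (Fin n) (Fin n) R) y x :=
    fun x y => by simp [Matrix.one_apply, eq_comm]
  simp only [genPos, Matrix.transpose_apply, Matrix.comp_apply, Matrix.of_apply, Fin.ext_iff]
  split_ifs <;> first | rfl | exact h1 _ _ | omega

theorem genFiedler_transpose (m i : ℕ) (Z : Matrix (Fin n) (Fin n) R)
    (A : ℕ → Matrix (Fin n) (Fin n) R) :
    (genFiedler m Z A i).transpose = genFiedler m Z.transpose (fun j => (A j).transpose) i := by
  unfold genFiedler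
  split_ifs
  · exact elemZero_transpose m Z
  · rw [genPos_transpose, Matrix.transpose_neg]

theorem genProd_transpose (m : ℕ) (Z : Matrix (Fin n) (Fin n) R)
    (A : ℕ → Matrix (Fin n) (Fin n) R) (l : List ℕ) :
    (genProd m Z A l).transpose
      = genProd m Z.transpose (fun j => (A j).transpose) l.reverse := by
  rw [genProd, Matrix.transpose_list_prod, genProd, List.map_map, ← List.map_reverse]
  congr 1
  refine List.map_congr_left fun i _ => ?_
  exact genFiedler_transpose m i Z A

theorem unitCol_transpose (m k : ℕ) : (unitCol R n m k).transpose = unitRow R n m k := by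
  ext a ⟨q, b⟩
  simp [unitCol, unitRow, blockCol, blockRow, Matrix.one_apply, eq_comm]

/-- Transposition reverses the product and keeps each factor a Fiedler matrix, so this is the column
statement for the reversed list. -/
theorem unitRow_mul_genProd (m : ℕ) (hm : 0 < m) (l : List ℕ) (hl : ∀ a ∈ l, a < m) (h0 : 0 ∉ l)
    (hnd : l.Nodup) (Z : Matrix (Fin n) (Fin n) R) (A : ℕ → Matrix (Fin n) (Fin n) R) :
    unitRow R n m 0 * genProd m Z A l = unitRow R n m (inversionCount l.reverse) := by
  have h := genProd_mul_unitCol m hm l.reverse (by simpa using hl) (by simpa)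
    (List.nodup_reverse.2 hnd) Z.transpose (fun j => (A j).transpose)
  rw [← genProd_transpose] at h
  have h' := congrArg Matrix.transpose h
  rwa [Matrix.transpose_mul, Matrix.transpose_transpose, unitCol_transpose, unitCol_transpose] at h'

end Columns

/-! ### Constant, polynomial and rational matrices -/

section Casts

variable {ι κ τ : Type*}

theorem const_mul [Fintype κ] (M : Matrix ι κ ℂ) (N : Matrix κ τ ℂ) :
    const (M * N) = const M * const N :=
  Matrix.map_mul (f := (Polynomial.C : ℂ →+* ℂ[X]))

theorem const_add (M N : Matrix ι κ ℂ) : const (M + N) = const M + const N :=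
  Matrix.map_add _ (fun _ _ => Polynomial.C_add) M N

theorem const_neg (M : Matrix ι κ ℂ) : const (-M) = -const M :=
  Matrix.map_neg _ (fun _ => Polynomial.C_neg) M

theorem const_one [DecidableEq ι] : const (1 : Matrix ι ι ℂ) = 1 :=
  Matrix.map_one _ Polynomial.C_0 Polynomial.C_1

theorem const_zero : const (0 : Matrix ι κ ℂ) = 0 :=
  Matrix.map_zero _ Polynomial.C_0

theorem toRat_mul [Fintype κ] (M : Matrix ι κ ℂ[X]) (N : Matrix κ τ ℂ[X]) :
    toRat (M * N) = toRat M * toRat N :=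
  Matrix.map_mul (f := algebraMap ℂ[X] (RatFunc ℂ))

theorem toRat_add (M N : Matrix ι κ ℂ[X]) : toRat (M + N) = toRat M + toRat N :=
  Matrix.map_add _ (map_add _) M N

theorem toRat_sub (M N : Matrix ι κ ℂ[X]) : toRat (M - N) = toRat M - toRat N :=
  Matrix.map_sub _ (map_sub _) M N

theorem toRat_smul (p : ℂ[X]) (M : Matrix ι κ ℂ[X]) :
    toRat (p • M) = algebraMap ℂ[X] (RatFunc ℂ) p • toRat M := by
  ext i j
  simp [toRat]

theorem det_toRat [Fintype ι] [DecidableEq ι] (M : Matrix ι ι ℂ[X]) :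
    (toRat M).det = algebraMap ℂ[X] (RatFunc ℂ) M.det :=
  ((algebraMap ℂ[X] (RatFunc ℂ)).map_det M).symm

end Casts

/-! ### Regularity of the pencil -/

/-- `λE - A = E (λI - E⁻¹A)`, and a characteristic polynomial is monic. -/
theorem det_pencil_ne_zero {r : ℕ} {E A : Matrix (Fin r) (Fin r) ℂ} (hE : E.det ≠ 0) :
    ((X : ℂ[X]) • const E - const A).det ≠ 0 := by
  have h : (X : ℂ[X]) • const E - const A
      = const E * (Matrix.charmatrix (E⁻¹ * A)) := by
    have hm : Matrix.charmatrix (E⁻¹ * A)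
        = Matrix.scalar (Fin r) (X : ℂ[X]) - const (E⁻¹ * A) := rfl
    rw [hm, Matrix.mul_sub, ← const_mul, ← mul_assoc,
      Matrix.mul_nonsing_inv _ (isUnit_iff_ne_zero.2 hE), one_mul, Matrix.scalar_apply,
      ← Matrix.smul_one_eq_diagonal, Matrix.mul_smul, Matrix.mul_one]
  rw [h, Matrix.det_mul]
  refine mul_ne_zero ?_ (Matrix.charpoly_monic (E⁻¹ * A)).ne_zero
  have : (const E).det = Polynomial.C E.det := ((Polynomial.C : ℂ →+* ℂ[X]).map_det E).symm
  rw [this]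
  simpa using hE

theorem isUnit_det_toRat_pencil {r : ℕ} {E A : Matrix (Fin r) (Fin r) ℂ} (hE : E.det ≠ 0) :
    IsUnit (toRat ((X : ℂ[X]) • const E - const A)).det := by
  rw [det_toRat, isUnit_iff_ne_zero]
  simpa using det_pencil_ne_zero hE

/-! ### Division by a regular pencil -/

/-- Division with constant remainder by `λ E - A` from the right. -/
theorem exists_eq_mul_pencil_add_const {ι : Type*} [Fintype ι] {r : ℕ}
    {E A : Matrix (Fin r) (Fin r) ℂ} (hE : E.det ≠ 0) (W : Matrix ι (Fin r) ℂ[X]) :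
    ∃ (Q : Matrix ι (Fin r) ℂ[X]) (W₀ : Matrix ι (Fin r) ℂ),
      W = Q * ((X : ℂ[X]) • const E - const A) + const W₀ := by
  classical
  let Div : Matrix ι (Fin r) ℂ[X] → Prop := fun W =>
    ∃ (Q : Matrix ι (Fin r) ℂ[X]) (W₀ : Matrix ι (Fin r) ℂ),
      W = Q * ((X : ℂ[X]) • const E - const A) + const W₀
  have hadd : ∀ W W', Div W → Div W' → Div (W + W') := by
    rintro _ _ ⟨Q, W₀, rfl⟩ ⟨Q', W₀', rfl⟩
    exact ⟨Q + Q', W₀ + W₀', by rw [Matrix.add_mul, const_add]; abel⟩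
  have hconst : ∀ W₀ : Matrix ι (Fin r) ℂ, Div (const W₀) := fun W₀ => ⟨0, W₀, by simp⟩
  have hX : ∀ W, Div W → Div ((X : ℂ[X]) • W) := by
    rintro _ ⟨Q, W₀, rfl⟩
    -- The remainder is kept constant by `λ W₀ = W₀E⁻¹ (λE - A) + W₀E⁻¹A`.
    refine ⟨(X : ℂ[X]) • Q + const (W₀ * E⁻¹), W₀ * E⁻¹ * A, ?_⟩
    have h : const W₀ = const (W₀ * E⁻¹) * const E := by
      rw [← const_mul, Matrix.mul_assoc, Matrix.nonsing_inv_mul _ (isUnit_iff_ne_zero.2 hE),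
        Matrix.mul_one]
    rw [const_mul (W₀ * E⁻¹) A]
    conv_lhs => rw [h]
    simp only [Matrix.mul_sub, Matrix.add_mul, Matrix.mul_smul, Matrix.smul_mul, smul_add,
      smul_sub]
    abel
  have hpow : ∀ (k : ℕ) (W₀ : Matrix ι (Fin r) ℂ), Div ((X : ℂ[X]) ^ k • const W₀) := by
    intro k W₀
    induction k with
    | zero => simpa using hconst W₀
    | succ k ih =>
      rw [pow_succ', mul_smul]
      exact hX _ ih
  have hpoly : ∀ (p : ℂ[X]) (W₀ : Matrix ι (Fin r) ℂ), Div (p • const W₀) := by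
    intro p W₀
    induction p using Polynomial.induction_on' with
    | add p q hp hq => rw [add_smul]; exact hadd _ _ hp hq
    | monomial k c =>
      have : (Polynomial.monomial k c) • const W₀ = (X : ℂ[X]) ^ k • const (c • W₀) := by
        ext1 i j
        simp [const, ← Polynomial.C_mul_X_pow_eq_monomial]
        ring
      rw [this]
      exact hpow _ _
  have hW : W = ∑ i, ∑ j, W i j • const (Matrix.single i j (1 : ℂ)) := by
    conv_lhs => rw [Matrix.matrix_eq_sum_single W]
    refine Finset.sum_congr rfl fun i _ => Finset.sum_congr rfl fun j _ => ?_
    ext1 a b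
    by_cases h : i = a ∧ j = b <;> simp [const, Matrix.single, h]
  have hzero : Div 0 := ⟨0, 0, by simp [const_zero]⟩
  change Div W
  rw [hW]
  refine Finset.sum_induction _ Div hadd hzero fun i _ => ?_
  exact Finset.sum_induction _ Div hadd hzero fun j _ => hpoly _ _

/-- Division with constant remainder by `λ E - A` from the left. -/
theorem exists_eq_pencil_mul_add_const {ι : Type*} [Fintype ι] {r : ℕ}
    {E A : Matrix (Fin r) (Fin r) ℂ} (hE : E.det ≠ 0) (W : Matrix (Fin r) ι ℂ[X]) :
    ∃ (Q : Matrix (Fin r) ι ℂ[X]) (W₀ : Matrix (Fin r) ι ℂ),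
      W = ((X : ℂ[X]) • const E - const A) * Q + const W₀ := by
  obtain ⟨Q, W₀, h⟩ := exists_eq_mul_pencil_add_const (E := E.transpose) (A := A.transpose)
    (by rwa [Matrix.det_transpose]) W.transpose
  refine ⟨Q.transpose, W₀.transpose, ?_⟩
  have h' := congrArg Matrix.transpose h
  rw [Matrix.transpose_transpose, Matrix.transpose_add, Matrix.transpose_mul] at h'
  exact h'

/-- A polynomial two-sided multiple of a rational matrix with a realization of size `s` has a
realization of size `s`. -/
theorem exists_realization_mul {ι κ : Type*} [Fintype ι] [Fintype κ] {s : ℕ}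
    (T : Realization ι s) (W : Matrix κ ι ℂ[X]) (W' : Matrix ι κ ℂ[X]) :
    ∃ T' : Realization κ s, T'.transfer = toRat W * T.transfer * toRat W' := by
  obtain ⟨Q, C₀, hC⟩ := exists_eq_mul_pencil_add_const (A := T.A) T.det_E (W * const T.C)
  obtain ⟨Q', B₀, hB⟩ := exists_eq_pencil_mul_add_const (A := T.A) T.det_E (const T.B * W')
  set D := (X : ℂ[X]) • const T.E - const T.A with hD
  have hu : IsUnit (toRat D).det := isUnit_det_toRat_pencil T.det_E
  -- With `W C = Q D + C₀` and `B W' = D Q' + B₀`, the product `W C D⁻¹ B W'` is polynomial up to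
  -- `C₀ D⁻¹ B₀`, over the same pencil `D`.
  refine ⟨⟨W * T.P * W' + Q * const T.B * W' + const C₀ * Q', C₀, T.E, T.A, B₀, T.det_E⟩, ?_⟩
  have hB' : toRat (const T.B) * toRat W' = toRat D * toRat Q' + toRat (const B₀) := by
    rw [← toRat_mul, hB, toRat_add, toRat_mul]
  have hC' : toRat W * toRat (const T.C) = toRat Q * toRat D + toRat (const C₀) := by
    rw [← toRat_mul, hC, toRat_add, toRat_mul]
  simp only [Realization.transfer, ← hD]
  rw [Matrix.mul_add, Matrix.add_mul]
  have h2 : toRat W * (toRat (const T.C) * (toRat D)⁻¹ * toRat (const T.B)) * toRat W'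
      = (toRat W * toRat (const T.C)) * (toRat D)⁻¹ * (toRat (const T.B) * toRat W') := by
    simp only [Matrix.mul_assoc]
  have h3 : toRat (const C₀) * (toRat D)⁻¹ * (toRat (const T.B) * toRat W')
      = toRat (const C₀) * toRat Q' + toRat (const C₀) * (toRat D)⁻¹ * toRat (const B₀) := by
    rw [hB', Matrix.mul_add, Matrix.mul_assoc _ _ (toRat D * toRat Q'),
      Matrix.nonsing_inv_mul_cancel_left _ _ hu]
  rw [h2, hC', Matrix.add_mul, Matrix.mul_nonsing_inv_cancel_right _ _ hu, Matrix.add_mul, h3]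
  simp only [toRat_add, toRat_mul, Matrix.mul_assoc]
  abel

/-! ### Proper rational functions -/

/-- `RatFunc.eval` respects sums and products only away from poles. There are finitely many poles,
so they do not affect limits at infinity. -/
theorem eventually_eval_denom_ne_zero (f : RatFunc ℂ) :
    ∀ᶠ z in Bornology.cobounded ℂ, Polynomial.eval₂ (RingHom.id ℂ) z f.denom ≠ 0 := by
  have hfin : {z : ℂ | Polynomial.eval₂ (RingHom.id ℂ) z f.denom = 0}.Finite := by
    have h : {z : ℂ | Polynomial.eval₂ (RingHom.id ℂ) z f.denom = 0} = f.denom.rootSet ℂ := by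
      ext z
      rw [Polynomial.mem_rootSet_of_ne f.denom_ne_zero]
      rfl
    rw [h]
    exact Polynomial.rootSet_finite _ _
  exact Bornology.isBounded_def.1 hfin.isBounded

theorem eventually_eval_add (f g : RatFunc ℂ) :
    (fun z : ℂ => RatFunc.eval (RingHom.id ℂ) z (f + g)) =ᶠ[Bornology.cobounded ℂ]
      fun z => RatFunc.eval (RingHom.id ℂ) z f + RatFunc.eval (RingHom.id ℂ) z g := by
  filter_upwards [eventually_eval_denom_ne_zero f, eventually_eval_denom_ne_zero g] with z hf hg
  exact RatFunc.eval_add _ _ hf hg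

theorem eventually_eval_mul (f g : RatFunc ℂ) :
    (fun z : ℂ => RatFunc.eval (RingHom.id ℂ) z (f * g)) =ᶠ[Bornology.cobounded ℂ]
      fun z => RatFunc.eval (RingHom.id ℂ) z f * RatFunc.eval (RingHom.id ℂ) z g := by
  filter_upwards [eventually_eval_denom_ne_zero f, eventually_eval_denom_ne_zero g] with z hf hg
  exact RatFunc.eval_mul _ _ hf hg

theorem eventually_eval_inv {f : RatFunc ℂ} (hf : f ≠ 0) :
    (fun z : ℂ => RatFunc.eval (RingHom.id ℂ) z f⁻¹) =ᶠ[Bornology.cobounded ℂ]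
      fun z => (RatFunc.eval (RingHom.id ℂ) z f)⁻¹ := by
  filter_upwards [eventually_eval_mul f f⁻¹] with z hz
  rw [mul_inv_cancel₀ hf, RatFunc.eval_one] at hz
  exact eq_inv_of_mul_eq_one_right hz.symm

/-- `f(λ)` tends to `d` as `λ → ∞`. -/
def HasLimit (f : RatFunc ℂ) (d : ℂ) : Prop :=
  Filter.Tendsto (fun z : ℂ => RatFunc.eval (RingHom.id ℂ) z f) (Bornology.cobounded ℂ) (nhds d)

theorem HasLimit.add {f g : RatFunc ℂ} {a b : ℂ} (hf : HasLimit f a) (hg : HasLimit g b) :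
    HasLimit (f + g) (a + b) :=
  (Filter.tendsto_congr' (eventually_eval_add f g)).2 (Filter.Tendsto.add hf hg)

theorem HasLimit.mul {f g : RatFunc ℂ} {a b : ℂ} (hf : HasLimit f a) (hg : HasLimit g b) :
    HasLimit (f * g) (a * b) :=
  (Filter.tendsto_congr' (eventually_eval_mul f g)).2 (Filter.Tendsto.mul hf hg)

/-- Complex numbers as rational functions. -/
def ratConst : ℂ →+* RatFunc ℂ := (algebraMap ℂ[X] (RatFunc ℂ)).comp Polynomial.C

theorem hasLimit_ratConst (c : ℂ) : HasLimit (ratConst c) c := by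
  have : (fun z : ℂ => RatFunc.eval (RingHom.id ℂ) z (ratConst c)) = fun _ => c := by
    funext z
    simp [ratConst, RatFunc.eval_C]
  rw [HasLimit, this]
  exact tendsto_const_nhds

theorem hasLimit_inv_X : HasLimit (RatFunc.X : RatFunc ℂ)⁻¹ 0 := by
  refine (Filter.tendsto_congr' (eventually_eval_inv RatFunc.X_ne_zero)).2 ?_
  simp only [RatFunc.eval_X]
  exact Filter.tendsto_inv₀_cobounded

theorem HasLimit.unique {f : RatFunc ℂ} {a b : ℂ} (ha : HasLimit f a) (hb : HasLimit f b) :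
    a = b :=
  tendsto_nhds_unique ha hb

theorem HasLimit.inv {f : RatFunc ℂ} {a : ℂ} (hf : HasLimit f a) (ha : a ≠ 0) :
    f ≠ 0 ∧ HasLimit f⁻¹ a⁻¹ := by
  have hf0 : f ≠ 0 := by
    rintro rfl
    refine ha (hf.unique ?_)
    simpa using hasLimit_ratConst 0
  exact ⟨hf0, (Filter.tendsto_congr' (eventually_eval_inv hf0)).2 (Filter.Tendsto.inv₀ hf ha)⟩

/-- The ring of proper rational functions, those which have a limit at infinity. -/
def properRing : Subring (RatFunc ℂ) where
  carrier := {f | ∃ d, HasLimit f d}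
  mul_mem' := by
    rintro _ _ ⟨a, ha⟩ ⟨b, hb⟩
    exact ⟨_, ha.mul hb⟩
  one_mem' := ⟨1, by simpa using hasLimit_ratConst 1⟩
  add_mem' := by
    rintro _ _ ⟨a, ha⟩ ⟨b, hb⟩
    exact ⟨_, ha.add hb⟩
  zero_mem' := ⟨0, by simpa using hasLimit_ratConst 0⟩
  neg_mem' := by
    rintro f ⟨a, ha⟩
    refine ⟨-1 * a, ?_⟩
    have := (hasLimit_ratConst (-1)).mul ha
    simpa using this

/-- The value at infinity of a proper rational function. -/
def limitHom : properRing →+* ℂ where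
  toFun f := f.2.choose
  map_one' := (1 : properRing).2.choose_spec.unique (by simpa using hasLimit_ratConst 1)
  map_zero' := (0 : properRing).2.choose_spec.unique (by simpa using hasLimit_ratConst 0)
  map_add' f g := (f + g).2.choose_spec.unique (f.2.choose_spec.add g.2.choose_spec)
  map_mul' f g := (f * g).2.choose_spec.unique (f.2.choose_spec.mul g.2.choose_spec)

theorem hasLimit_limitHom (f : properRing) : HasLimit f (limitHom f) := f.2.choose_spec

theorem limitHom_eq {f : properRing} {d : ℂ} (h : HasLimit f d) : limitHom f = d :=
  (hasLimit_limitHom f).unique h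

/-- A nonzero limit makes the inverse proper too, so units can be detected at infinity. -/
theorem isUnit_of_limitHom_ne_zero {f : properRing} (h : limitHom f ≠ 0) : IsUnit f := by
  obtain ⟨h0, hi⟩ := (hasLimit_limitHom f).inv h
  exact IsUnit.of_mul_eq_one (⟨(f : RatFunc ℂ)⁻¹, _, hi⟩ : properRing)
    (Subtype.ext (mul_inv_cancel₀ h0))

theorem isBiproper_map {ι : Type*} [Fintype ι] [DecidableEq ι] {U : Matrix ι ι properRing}
    (hU : IsUnit U.det) : IsBiproper (U.map properRing.subtype) := by
  refine ⟨U.map limitHom, ?_, ?_⟩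
  · refine tendsto_pi_nhds.2 fun i => tendsto_pi_nhds.2 fun j => ?_
    exact hasLimit_limitHom (U i j)
  · have h : (U.map limitHom).det = limitHom U.det := (limitHom.map_det U).symm
    rw [h]
    exact (hU.map limitHom).ne_zero

/-- Complex numbers as proper rational functions. -/
def properConst : ℂ →+* properRing :=
  ratConst.codRestrict properRing fun c => ⟨c, hasLimit_ratConst c⟩

/-- The proper rational function `λ⁻¹`. -/
def properInvX : properRing := ⟨(RatFunc.X : RatFunc ℂ)⁻¹, 0, hasLimit_inv_X⟩

theorem toRat_const {ι κ : Type*} (M : Matrix ι κ ℂ) : toRat (const M) = M.map ratConst := rfl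

/-- The inverse of a pencil `λ E - A` with `E` nonsingular is proper. -/
theorem exists_proper_pencil_inv {r : ℕ} {E A : Matrix (Fin r) (Fin r) ℂ} (hE : E.det ≠ 0) :
    ∃ N : Matrix (Fin r) (Fin r) properRing,
      (toRat ((X : ℂ[X]) • const E - const A))⁻¹ = N.map properRing.subtype := by
  -- `M = E - λ⁻¹A` is `λ⁻¹` times the pencil and tends to `E`, hence is invertible over the proper
  -- ring.
  set M : Matrix (Fin r) (Fin r) properRing :=
    E.map properConst - properInvX • A.map properConst with hM
  have hlim : M.map limitHom = E := by
    ext i j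
    have h1 : ∀ c, limitHom (properConst c) = c := fun c => limitHom_eq (hasLimit_ratConst c)
    have h2 : limitHom properInvX = 0 := limitHom_eq hasLimit_inv_X
    simp [hM, h1, h2]
  have hdet : IsUnit M.det := by
    apply isUnit_of_limitHom_ne_zero
    have h : (M.map limitHom).det = limitHom M.det := (limitHom.map_det M).symm
    rwa [← h, hlim]
  have hMr : M.map properRing.subtype
      = (RatFunc.X : RatFunc ℂ)⁻¹ • toRat ((X : ℂ[X]) • const E - const A) := by
    rw [toRat_sub, toRat_smul, RatFunc.algebraMap_X, smul_sub, smul_smul,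
      inv_mul_cancel₀ RatFunc.X_ne_zero, one_smul]
    rfl
  refine ⟨properInvX • M⁻¹, Matrix.inv_eq_right_inv ?_⟩
  have h1 : (properInvX • M⁻¹).map properRing.subtype
      = (RatFunc.X : RatFunc ℂ)⁻¹ • (M⁻¹).map properRing.subtype := rfl
  have h2 : M.map properRing.subtype * (M⁻¹).map properRing.subtype = 1 := by
    rw [← Matrix.map_mul, Matrix.mul_nonsing_inv _ hdet]
    exact Matrix.map_one _ (map_zero _) (map_one _)
  rw [h1, Matrix.mul_smul, ← Matrix.smul_mul, ← hMr, h2]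

/-! ### Change of rings -/

section Map

variable {R R' : Type*} [CommRing R] [CommRing R'] (φ : R →+* R') {n : ℕ}

theorem elemZero_map (m : ℕ) (Y : Matrix (Fin n) (Fin n) R) :
    (elemZero m Y).map φ = elemZero m (Y.map φ) := by
  ext ⟨p, a⟩ ⟨q, b⟩
  simp only [elemZero, Matrix.map_apply, Matrix.comp_apply, Matrix.of_apply]
  split_ifs <;> simp [Matrix.one_apply, apply_ite φ]

theorem genNegTop_map (m : ℕ) (Y : Matrix (Fin n) (Fin n) R) :
    (genNegTop m Y).map φ = genNegTop m (Y.map φ) := by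
  ext ⟨p, a⟩ ⟨q, b⟩
  simp only [genNegTop, Matrix.map_apply, Matrix.comp_apply, Matrix.of_apply]
  split_ifs <;> simp [Matrix.one_apply, apply_ite φ]

theorem genPos_map (m i : ℕ) (Y : Matrix (Fin n) (Fin n) R) :
    (genPos m i Y).map φ = genPos m i (Y.map φ) := by
  ext ⟨p, a⟩ ⟨q, b⟩
  simp only [genPos, Matrix.map_apply, Matrix.comp_apply, Matrix.of_apply]
  split_ifs <;> simp [Matrix.one_apply, apply_ite φ]

theorem genFiedler_map (m i : ℕ) (Z : Matrix (Fin n) (Fin n) R)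
    (A : ℕ → Matrix (Fin n) (Fin n) R) :
    (genFiedler m Z A i).map φ = genFiedler m (Z.map φ) (fun j => (A j).map φ) i := by
  unfold genFiedler
  split_ifs
  · exact elemZero_map φ m Z
  · rw [genPos_map, Matrix.map_neg _ (map_neg φ)]

theorem genProd_map (m : ℕ) (Z : Matrix (Fin n) (Fin n) R)
    (A : ℕ → Matrix (Fin n) (Fin n) R) (l : List ℕ) :
    (genProd m Z A l).map φ = genProd m (Z.map φ) (fun j => (A j).map φ) l := by
  have h := map_list_prod φ.mapMatrix (l.map (genFiedler m Z A))
  rw [List.map_map] at h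
  refine h.trans ?_
  rw [genProd]
  congr 1
  refine List.map_congr_left fun i _ => ?_
  exact genFiedler_map φ m i Z A

theorem blockCol_map (m k : ℕ) {r : ℕ} (Y : Matrix (Fin n) (Fin r) R) :
    (blockCol m k Y).map φ = blockCol m k (Y.map φ) := by
  ext ⟨p, a⟩ b
  simp only [blockCol, Matrix.map_apply, Matrix.of_apply]
  split_ifs <;> simp

theorem blockRow_map (m k : ℕ) {r : ℕ} (Y : Matrix (Fin r) (Fin n) R) :
    (blockRow m k Y).map φ = blockRow m k (Y.map φ) := by
  ext b ⟨p, a⟩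
  simp only [blockRow, Matrix.map_apply, Matrix.of_apply]
  split_ifs <;> simp

theorem unitCol_map (m k : ℕ) : (unitCol R n m k).map φ = unitCol R' n m k := by
  rw [unitCol, blockCol_map, Matrix.map_one _ (map_zero φ) (map_one φ), unitCol]

theorem unitRow_map (m k : ℕ) : (unitRow R n m k).map φ = unitRow R' n m k := by
  rw [unitRow, blockRow_map, Matrix.map_one _ (map_zero φ) (map_one φ), unitRow]

end Map

/-! ### Index tuples -/

theorem tuple_perm {m : ℕ} (σ : Equiv.Perm (Fin m)) : (tuple σ).Perm (List.range m) := by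
  have h := Equiv.Perm.ofFn_comp_perm σ (fun i : Fin m => (i : ℕ))
  have h2 : List.ofFn (fun i : Fin m => (i : ℕ)) = List.range m := by
    refine List.ext_getElem (by simp) fun i h1 h2 => by simp
  rw [h2] at h
  exact h

theorem exists_tuple_split {m : ℕ} (hm : 1 ≤ m) (σ : Equiv.Perm (Fin m)) :
    ∃ l₁ l₂ : List ℕ, tuple σ = l₁ ++ 0 :: l₂ ∧ 0 ∉ l₁ ∧ 0 ∉ l₂ ∧ l₁.Nodup ∧ l₂.Nodup ∧
      (∀ i ∈ l₁, i < m) ∧ (∀ i ∈ l₂, i < m) := by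
  have hp := tuple_perm σ
  have h0 : 0 ∈ tuple σ := hp.mem_iff.2 (by simp; omega)
  obtain ⟨l₁, l₂, h⟩ := List.append_of_mem h0
  have hnd : (tuple σ).Nodup := hp.nodup_iff.2 List.nodup_range
  have hlt : ∀ i ∈ tuple σ, i < m := fun i hi => List.mem_range.1 (hp.mem_iff.1 hi)
  rw [h] at hnd hlt
  have hnd' := List.nodup_middle.1 hnd
  rw [List.nodup_cons, List.mem_append, not_or] at hnd'
  refine ⟨l₁, l₂, h, hnd'.1.1, hnd'.1.2, hnd'.2.of_append_left, hnd'.2.of_append_right,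
    fun i hi => hlt i (by simp [hi]), fun i hi => hlt i (by simp [hi])⟩

/-! ### The Fiedler pencil of the system matrix: border, equivalence, minimality, behaviour at
infinity. -/

section Pencils

variable {m n r : ℕ}

/-- The coefficients of a matrix polynomial, as a sequence. -/
def coeffSeq (A : Fin (m + 1) → Matrix (Fin n) (Fin n) ℂ) (j : ℕ) : Matrix (Fin n) (Fin n) ℂ :=
  if h : j < m + 1 then A ⟨j, h⟩ else 0

theorem coeffSeq_val (A : Fin (m + 1) → Matrix (Fin n) (Fin n) ℂ) (j : Fin (m + 1)) :
    coeffSeq A j = A j := dif_pos j.2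

theorem matPoly_eq_sum (k : ℕ) (A : Fin (k + 1 + 1) → Matrix (Fin n) (Fin n) ℂ) :
    matPoly A = (X : ℂ[X]) ^ (k + 1) • const (coeffSeq A (k + 1))
      + ∑ j ∈ Finset.range k, (X : ℂ[X]) ^ (j + 1) • const (coeffSeq A (j + 1))
      + const (coeffSeq A 0) := by
  have h : matPoly A = ∑ j ∈ Finset.range (k + 1 + 1), (X : ℂ[X]) ^ j • const (coeffSeq A j) := by
    rw [matPoly, ← Fin.sum_univ_eq_sum_range]
    simp only [coeffSeq_val]
  rw [h, Finset.sum_range_succ, Finset.sum_range_succ']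
  simp only [pow_zero, one_smul]
  abel

theorem fiedlerP_eq (A : Fin (m + 1) → Matrix (Fin n) (Fin n) ℂ) (i : Fin m) :
    fiedlerP A i = genFiedler m (-coeffSeq A 0) (coeffSeq A) i := by
  have h : coeffSeq A i = A i.castSucc := coeffSeq_val A i.castSucc
  unfold fiedlerP genFiedler
  split_ifs with h0
  · rw [← h, h0]
  · rw [h]; rfl

theorem prod_fiedlerP (A : Fin (m + 1) → Matrix (Fin n) (Fin n) ℂ) (σ : Equiv.Perm (Fin m)) :
    (List.ofFn fun k => fiedlerP A (σ k)).prod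
      = genProd m (-coeffSeq A 0) (coeffSeq A) (tuple σ) := by
  rw [genProd, tuple, List.map_ofFn]
  simp only [fiedlerP_eq]
  rfl

theorem fiedlerPNeg_eq (A : Fin (m + 1) → Matrix (Fin n) (Fin n) ℂ) :
    fiedlerPNeg A = genNegTop m (coeffSeq A m) := by
  have h : coeffSeq A m = A (Fin.last m) := coeffSeq_val A (Fin.last m)
  rw [h]
  rfl

/-- The Fiedler matrices of the system matrix, indexed by natural numbers. -/
def genFiedlerS (A : Fin (m + 1) → Matrix (Fin n) (Fin n) ℂ)
    (S : Realization (Fin n) r) (i : ℕ) :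
    Matrix ((Fin m × Fin n) ⊕ Fin r) ((Fin m × Fin n) ⊕ Fin r) ℂ :=
  if i = 0 then Matrix.fromBlocks (elemZero m (-coeffSeq A 0))
    (-blockCol m 0 S.C) (-blockRow m 0 S.B) (-S.A)
  else Matrix.fromBlocks (genFiedler m 0 (coeffSeq A) i) 0 0 1

theorem fiedlerS_eq (A : Fin (m + 1) → Matrix (Fin n) (Fin n) ℂ)
    (S : Realization (Fin n) r) (i : Fin m) : fiedlerS A S i = genFiedlerS A S i := by
  unfold fiedlerS genFiedlerS
  rw [fiedlerP_eq]
  split_ifs with h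
  · simp [genFiedler, h]
  · simp [genFiedler, h]

theorem prod_genFiedlerS (A : Fin (m + 1) → Matrix (Fin n) (Fin n) ℂ)
    (S : Realization (Fin n) r) (l : List ℕ) (hl : 0 ∉ l) :
    (l.map (genFiedlerS A S)).prod = Matrix.fromBlocks (genProd m 0 (coeffSeq A) l) 0 0 1 := by
  induction l with
  | nil => simp [genProd, Matrix.fromBlocks_one]
  | cons a l ih =>
    have ha : a ≠ 0 := fun h => hl (by simp [h])
    rw [List.map_cons, List.prod_cons, ih fun h => hl (by simp [h])]
    simp [genFiedlerS, ha, genProd, Matrix.fromBlocks_multiply]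

variable {l₁ l₂ : List ℕ} {σ : Equiv.Perm (Fin m)}

/-- Only the factor of index 0 couples to the state space; the factors before it act on the column
`C`, those after it on the row `B`. -/
theorem prod_fiedlerS (A : Fin (m + 1) → Matrix (Fin n) (Fin n) ℂ)
    (S : Realization (Fin n) r) (hσ : tuple σ = l₁ ++ 0 :: l₂) (h₁ : 0 ∉ l₁) (h₂ : 0 ∉ l₂) :
    (List.ofFn fun k => fiedlerS A S (σ k)).prod
      = Matrix.fromBlocks (genProd m (-coeffSeq A 0) (coeffSeq A) (tuple σ))
        (-(genProd m 0 (coeffSeq A) l₁ * unitCol ℂ n m 0 * S.C))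
        (-(S.B * (unitRow ℂ n m 0 * genProd m 0 (coeffSeq A) l₂))) (-S.A) := by
  have h : (List.ofFn fun k => fiedlerS A S (σ k)) = (tuple σ).map (genFiedlerS A S) := by
    rw [tuple, List.map_ofFn]
    simp only [fiedlerS_eq]
    rfl
  rw [h, hσ, genProd_middle _ _ _ _ _ h₁ h₂, List.map_append, List.map_cons, List.prod_append,
    List.prod_cons, prod_genFiedlerS A S l₁ h₁, prod_genFiedlerS A S l₂ h₂, genFiedlerS, if_pos rfl,
    Matrix.fromBlocks_multiply, Matrix.fromBlocks_multiply, blockCol_eq_mul, blockRow_eq_mul]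
  simp [Matrix.mul_assoc]

/-- Used to absorb `C(λE - A)⁻¹B` into the constant coefficient of a Fiedler product. -/
theorem genProd_sub {R : Type*} [CommRing R] (k : ℕ) (Z H : Matrix (Fin n) (Fin n) R)
    (A : ℕ → Matrix (Fin n) (Fin n) R) (h₁ : 0 ∉ l₁) (h₂ : 0 ∉ l₂) :
    genProd (k + 1) (Z - H) A (l₁ ++ 0 :: l₂) = genProd (k + 1) Z A (l₁ ++ 0 :: l₂)
      - (genProd (k + 1) 0 A l₁ * unitCol R n (k + 1) 0) * H
        * (unitRow R n (k + 1) 0 * genProd (k + 1) 0 A l₂) := by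
  rw [genProd_middle _ _ _ _ _ h₁ h₂, genProd_middle _ _ _ _ _ h₁ h₂, elemZero_eq_add,
    elemZero_eq_add k Z]
  simp only [Matrix.mul_sub, Matrix.sub_mul, Matrix.mul_add, Matrix.add_mul, Matrix.mul_assoc]
  abel

theorem pencilP_eq (A : Fin (m + 1) → Matrix (Fin n) (Fin n) ℂ) (σ : Equiv.Perm (Fin m)) :
    pencilP A σ = (X : ℂ[X]) • genNegTop m (const (coeffSeq A m))
      - genProd m (-const (coeffSeq A 0)) (fun j => const (coeffSeq A j)) (tuple σ) := by
  have h1 : const (genNegTop m (coeffSeq A m)) = genNegTop m (const (coeffSeq A m)) :=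
    genNegTop_map Polynomial.C m _
  have h2 : const (genProd m (-coeffSeq A 0) (coeffSeq A) (tuple σ))
      = genProd m (const (-coeffSeq A 0)) (fun j => const (coeffSeq A j)) (tuple σ) :=
    genProd_map Polynomial.C m _ _ _
  rw [pencilP, fiedlerPNeg_eq, prod_fiedlerP, h1, h2, const_neg]

theorem const_blockCol (m k : ℕ) (Y : Matrix (Fin n) (Fin r) ℂ) :
    const (blockCol m k Y) = unitCol ℂ[X] n m k * const Y := by
  rw [← blockCol_eq_mul]
  exact blockCol_map Polynomial.C m k Y

theorem const_blockRow (m k : ℕ) (Y : Matrix (Fin r) (Fin n) ℂ) :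
    const (blockRow m k Y) = const Y * unitRow ℂ[X] n m k := by
  rw [← blockRow_eq_mul]
  exact blockRow_map Polynomial.C m k Y

theorem isUnimodular_of_isUnit {ι : Type*} [Fintype ι] [DecidableEq ι] {U : Matrix ι ι ℂ[X]}
    (hU : IsUnit U.det) : IsUnimodular U := by
  obtain ⟨c, hc, h⟩ := Polynomial.isUnit_iff.1 hU
  exact ⟨c, hc.ne_zero, h.symm⟩

/-- The realization read off from a Fiedler pencil. -/
def pencilRealization (A : Fin (m + 1) → Matrix (Fin n) (Fin n) ℂ) (S : Realization (Fin n) r)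
    (σ : Equiv.Perm (Fin m)) (c₀ i₀ : ℕ) : Realization (Fin m × Fin n) r :=
  ⟨pencilP A σ, blockCol m i₀ S.C, S.E, S.A, blockRow m c₀ S.B, S.det_E⟩

theorem pencilS_eq_systemMatrix (A : Fin (m + 1) → Matrix (Fin n) (Fin n) ℂ)
    (S : Realization (Fin n) r) (hσ : tuple σ = l₁ ++ 0 :: l₂) (h₁ : 0 ∉ l₁) (h₂ : 0 ∉ l₂)
    {c₀ i₀ : ℕ} (hc : unitRow ℂ n m 0 * genProd m 0 (coeffSeq A) l₂ = unitRow ℂ n m c₀)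
    (hi : genProd m 0 (coeffSeq A) l₁ * unitCol ℂ n m 0 = unitCol ℂ n m i₀) :
    pencilS A S σ = (pencilRealization A S σ c₀ i₀).systemMatrix := by
  rw [pencilS, prod_fiedlerS A S hσ h₁ h₂, hc, hi, ← blockCol_eq_mul, ← blockRow_eq_mul,
    fiedlerSNeg]
  simp only [Realization.systemMatrix, pencilRealization, pencilP, prod_fiedlerP]
  ext1 i j
  rcases i with i | i <;> rcases j with j | j <;> simp [const]
  ring

/-- The unimodular transformations of a Fiedler pencil, together with their action on the block
row and column attached to the state space. -/
theorem exists_unimodular (k : ℕ) (A : Fin (k + 1 + 1) → Matrix (Fin n) (Fin n) ℂ)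
    {σ : Equiv.Perm (Fin (k + 1))} (hσ : tuple σ = l₁ ++ 0 :: l₂) (h₁ : 0 ∉ l₁) (h₂ : 0 ∉ l₂)
    {c₀ i₀ : ℕ}
    (hc : unitRow ℂ[X] n (k + 1) 0 * genProd (k + 1) 0 (fun j => const (coeffSeq A j)) l₂
      = unitRow ℂ[X] n (k + 1) c₀)
    (hi : genProd (k + 1) 0 (fun j => const (coeffSeq A j)) l₁ * unitCol ℂ[X] n (k + 1) 0
      = unitCol ℂ[X] n (k + 1) i₀) :
    ∃ U V : Matrix (Fin (k + 1) × Fin n) (Fin (k + 1) × Fin n) ℂ[X],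
      IsUnimodular U ∧ IsUnimodular V ∧
      U * pencilP A σ * V = elemZero (k + 1) (matPoly A) ∧
      U * unitCol ℂ[X] n (k + 1) i₀ = unitCol ℂ[X] n (k + 1) 0 ∧
      unitRow ℂ[X] n (k + 1) c₀ * V = unitRow ℂ[X] n (k + 1) 0 := by
  obtain ⟨U, V, hU, hV, h, hu, hv⟩ := exists_pencil_equiv_normalized k (X : ℂ[X])
    (fun j => const (coeffSeq A j)) l₁ l₂ (hσ ▸ tuple_perm σ) h₁ h₂ (const (coeffSeq A (k + 1)))
  refine ⟨U, V, isUnimodular_of_isUnit hU, isUnimodular_of_isUnit hV, ?_, ?_, ?_⟩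
  · rw [pencilP_eq, hσ, h, matPoly_eq_sum, sub_neg_eq_add]
  · rw [← hi, hu]
  · rw [← hc, hv]

theorem systemEquivalent_of_unimodular {k : ℕ} {A : Fin (k + 1 + 1) → Matrix (Fin n) (Fin n) ℂ}
    {S : Realization (Fin n) r} (hP : S.P = matPoly A) {σ : Equiv.Perm (Fin (k + 1))} {c₀ i₀ : ℕ}
    {U V : Matrix (Fin (k + 1) × Fin n) (Fin (k + 1) × Fin n) ℂ[X]}
    (hU : IsUnimodular U) (hV : IsUnimodular V)
    (h : U * pencilP A σ * V = elemZero (k + 1) (matPoly A))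
    (hu : U * unitCol ℂ[X] n (k + 1) i₀ = unitCol ℂ[X] n (k + 1) 0)
    (hv : unitRow ℂ[X] n (k + 1) c₀ * V = unitRow ℂ[X] n (k + 1) 0) :
    SystemEquivalent S (pencilRealization A S σ c₀ i₀).systemMatrix := by
  refine ⟨U, V, 1, 1, hU, hV, by simp, by simp, ?_⟩
  rw [const_one, Realization.systemMatrix, Matrix.fromBlocks_multiply, Matrix.fromBlocks_multiply,
    diagOne, Realization.systemMatrix, Matrix.toBlocks_fromBlocks₁₁, Matrix.toBlocks_fromBlocks₁₂,
    Matrix.toBlocks_fromBlocks₂₁, Matrix.toBlocks_fromBlocks₂₂, hP]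
  simp only [pencilRealization, Matrix.zero_mul, Matrix.mul_zero, add_zero, zero_add,
    Matrix.one_mul, Matrix.mul_one, h, const_blockCol, const_blockRow]
  rw [← Matrix.mul_assoc, hu, Matrix.mul_assoc, hv, ← blockCol_eq_mul, ← blockRow_eq_mul]

/-- With `f = e_m^T ⊗ I` and `e = e_m ⊗ I`, the normalization gives `(f U) 𝔾 (V e) = G`, so every
realization of `𝔾` yields one of `G` of the same size. -/
theorem isMinimal_of_unimodular {k : ℕ} {A : Fin (k + 1 + 1) → Matrix (Fin n) (Fin n) ℂ}
    {S : Realization (Fin n) r} (hP : S.P = matPoly A) (hmin : S.IsMinimal)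
    {σ : Equiv.Perm (Fin (k + 1))} {c₀ i₀ : ℕ}
    {U V : Matrix (Fin (k + 1) × Fin n) (Fin (k + 1) × Fin n) ℂ[X]}
    (h : U * pencilP A σ * V = elemZero (k + 1) (matPoly A))
    (hu : U * unitCol ℂ[X] n (k + 1) i₀ = unitCol ℂ[X] n (k + 1) 0)
    (hv : unitRow ℂ[X] n (k + 1) c₀ * V = unitRow ℂ[X] n (k + 1) 0) :
    (pencilRealization A S σ c₀ i₀).IsMinimal := by
  intro s T hT
  obtain ⟨T', hT'⟩ := exists_realization_mul T (unitRow ℂ[X] n (k + 1) 0 * U)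
    (V * unitCol ℂ[X] n (k + 1) 0)
  refine hmin s T' ?_
  rw [hT', hT]
  simp only [Realization.transfer, pencilRealization, const_blockCol, const_blockRow, toRat_mul]
  have e1 : toRat U * toRat (unitCol ℂ[X] n (k + 1) i₀) = toRat (unitCol ℂ[X] n (k + 1) 0) := by
    rw [← toRat_mul, hu]
  have e2 : toRat (unitRow ℂ[X] n (k + 1) c₀) * toRat V = toRat (unitRow ℂ[X] n (k + 1) 0) := by
    rw [← toRat_mul, hv]
  have e3 : toRat (unitRow ℂ[X] n (k + 1) 0) * toRat (unitCol ℂ[X] n (k + 1) 0) = 1 := by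
    rw [← toRat_mul, unitRow_mul_unitCol]
    exact Matrix.map_one _ (map_zero _) (map_one _)
  have e4 : toRat U * toRat (pencilP A σ) * toRat V = toRat (elemZero (k + 1) (matPoly A)) := by
    rw [← toRat_mul, ← toRat_mul, h]
  have e5 : toRat (unitRow ℂ[X] n (k + 1) 0) * toRat (elemZero (k + 1) (matPoly A))
      * toRat (unitCol ℂ[X] n (k + 1) 0) = toRat S.P := by
    rw [← toRat_mul, unitRow_mul_elemZero, ← toRat_mul, Matrix.mul_assoc, unitRow_mul_unitCol,
      Matrix.mul_one, hP]
  set a := toRat (unitRow ℂ[X] n (k + 1) 0)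
  set b := toRat (unitCol ℂ[X] n (k + 1) 0)
  set D := (toRat ((X : ℂ[X]) • const S.E - const S.A))⁻¹
  rw [Matrix.mul_add, Matrix.add_mul, ← e5, ← e4]
  congr 1
  · simp only [Matrix.mul_assoc]
  · calc a * toRat U * (toRat (unitCol ℂ[X] n (k + 1) i₀) * toRat (const S.C) * D
          * (toRat (const S.B) * toRat (unitRow ℂ[X] n (k + 1) c₀))) * (toRat V * b)
        = a * (toRat U * toRat (unitCol ℂ[X] n (k + 1) i₀)) * (toRat (const S.C) * D
          * toRat (const S.B)) * (toRat (unitRow ℂ[X] n (k + 1) c₀) * toRat V) * b := by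
          simp only [Matrix.mul_assoc]
      _ = (a * b) * (toRat (const S.C) * D * toRat (const S.B)) * (a * b) := by
          rw [e1, e2]; simp only [Matrix.mul_assoc]
      _ = _ := by rw [e3, Matrix.one_mul, Matrix.mul_one]

/-- `λ⁻¹𝔾` is the reversed Fiedler pencil with `A_0` replaced by the proper matrix `A_0 + C(λE -
A)⁻¹B`; its reduction is carried out over `properRing` and then mapped to rational functions. -/
theorem biproperEquivalent_pencilRealization {k : ℕ}
    (A : Fin (k + 1 + 1) → Matrix (Fin n) (Fin n) ℂ)
    (S : Realization (Fin n) r) (hP : S.P = matPoly A) {σ : Equiv.Perm (Fin (k + 1))}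
    (hσ : tuple σ = l₁ ++ 0 :: l₂) (h₁ : 0 ∉ l₁) (h₂ : 0 ∉ l₂) {c₀ i₀ : ℕ}
    (hc : unitRow (RatFunc ℂ) n (k + 1) 0 *
        genProd (k + 1) 0 (fun j => (coeffSeq A j).map ratConst) l₂
      = unitRow (RatFunc ℂ) n (k + 1) c₀)
    (hi : genProd (k + 1) 0 (fun j => (coeffSeq A j).map ratConst) l₁ *
        unitCol (RatFunc ℂ) n (k + 1) 0
      = unitCol (RatFunc ℂ) n (k + 1) i₀) :
    BiproperEquivalent S.transfer (pencilRealization A S σ c₀ i₀).transfer := by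
  obtain ⟨N, hN⟩ := exists_proper_pencil_inv (A := S.A) S.det_E
  set ψ := properRing.subtype
  set HO : Matrix (Fin n) (Fin n) properRing := S.C.map properConst * N * S.B.map properConst
  set H : Matrix (Fin n) (Fin n) (RatFunc ℂ) := toRat (const S.C) *
    (toRat ((X : ℂ[X]) • const S.E - const S.A))⁻¹ * toRat (const S.B) with hH
  have hψc : ∀ {a b : Type} (M : Matrix a b ℂ), (M.map properConst).map ψ = M.map ratConst :=
    fun M => rfl
  have hHO : HO.map ψ = H := by
    rw [Matrix.map_mul, Matrix.map_mul, hψc, hψc, ← hN, hH, toRat_const, toRat_const]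
  have hψX : ψ properInvX = (RatFunc.X : RatFunc ℂ)⁻¹ := rfl
  -- The reversal lemma is applied with `t = λ⁻¹` and no initial scaling.
  set AR : ℕ → Matrix (Fin n) (Fin n) (RatFunc ℂ) := fun j => (coeffSeq A j).map ratConst with hAR
  obtain ⟨U, V, hU, hV, h⟩ := exists_reversal_equiv k properInvX 1 1
    (fun j => (coeffSeq A j).map properConst) (tuple σ) (tuple_perm σ)
    ((coeffSeq A (k + 1)).map properConst) (-(coeffSeq A 0).map properConst - HO)
  refine ⟨U.map ψ, V.map ψ, isBiproper_map hU, isBiproper_map hV, ?_⟩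
  have hone : genNegTop (k + 1) (1 : Matrix (Fin n) (Fin n) properRing) = 1 := by
    rw [genNegTop_succ]; simp [Matrix.fromBlocks_one]
  simp only [one_smul, hone, one_mul, mul_one] at h
  have hsmul : ∀ {a b : Type} (t : properRing) (M : Matrix a b properRing),
      (t • M).map ψ = ψ t • M.map ψ := fun t M => by ext; simp
  have hZ : (-(coeffSeq A 0).map properConst - HO).map ψ = -AR 0 - H := by
    rw [Matrix.map_sub _ (map_sub ψ), Matrix.map_neg _ (map_neg ψ), hψc, hHO]
  have hsum : (∑ j ∈ Finset.range k,
      properInvX ^ (k - j) • (coeffSeq A (j + 1)).map properConst).map ψ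
      = ∑ j ∈ Finset.range k, (RatFunc.X : RatFunc ℂ)⁻¹ ^ (k - j) • AR (j + 1) := by
    refine (map_sum ψ.mapMatrix _ _).trans (Finset.sum_congr rfl fun j _ => ?_)
    rw [RingHom.mapMatrix_apply, hsmul, map_pow, hψX, hψc]
  have h' := congrArg (fun M => M.map ψ) h
  rw [Matrix.map_mul, Matrix.map_mul, Matrix.map_sub _ (map_sub ψ), hsmul, genNegTop_map,
    genProd_map, hZ, elemZero_map, Matrix.map_sub _ (map_sub ψ), Matrix.map_add _ (map_add ψ),
    hsmul, hZ, hsum, map_pow, hψX, hψc] at h'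
  have hpencil : toRat (pencilP A σ) = (RatFunc.X : RatFunc ℂ) • genNegTop (k + 1) (AR (k + 1))
      - genProd (k + 1) (-AR 0) AR (tuple σ) := by
    rw [pencilP_eq, toRat_sub, toRat_smul, RatFunc.algebraMap_X]
    congr 1
    · exact congrArg _ (genNegTop_map _ _ _)
    · refine (genProd_map _ _ _ _ _).trans ?_
      rw [Matrix.map_neg _ (map_neg _)]
      rfl
  have hcol : toRat (const (blockCol (k + 1) i₀ S.C))
      = unitCol (RatFunc ℂ) n (k + 1) i₀ * toRat (const S.C) := by
    rw [const_blockCol, toRat_mul]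
    exact congrArg (· * _) (unitCol_map _ _ _)
  have hrow : toRat (const (blockRow (k + 1) c₀ S.B))
      = toRat (const S.B) * unitRow (RatFunc ℂ) n (k + 1) c₀ := by
    rw [const_blockRow, toRat_mul]
    exact congrArg (_ * ·) (unitRow_map _ _ _)
  have hleft : (RatFunc.X : RatFunc ℂ)⁻¹ • (pencilRealization A S σ c₀ i₀).transfer
      = genNegTop (k + 1) (AR (k + 1))
        - (RatFunc.X : RatFunc ℂ)⁻¹ • genProd (k + 1) (-AR 0 - H) AR (tuple σ) := by
    simp only [Realization.transfer, pencilRealization]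
    rw [hpencil, hcol, hrow, hσ, genProd_sub k _ _ _ h₁ h₂, hc, hi, smul_add, smul_sub, smul_smul,
      inv_mul_cancel₀ RatFunc.X_ne_zero, one_smul, smul_sub, hH]
    simp only [Matrix.mul_assoc]
    abel
  have hright : ((RatFunc.X : RatFunc ℂ) ^ (k + 1))⁻¹ • S.transfer
      = AR (k + 1) + ∑ j ∈ Finset.range k, (RatFunc.X : RatFunc ℂ)⁻¹ ^ (k - j) • AR (j + 1)
        - (RatFunc.X : RatFunc ℂ)⁻¹ ^ (k + 1) • (-AR 0 - H) := by
    have hX : (RatFunc.X : RatFunc ℂ) ≠ 0 := RatFunc.X_ne_zero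
    have hPR : toRat S.P = (RatFunc.X : RatFunc ℂ) ^ (k + 1) • AR (k + 1)
        + ∑ j ∈ Finset.range k, (RatFunc.X : RatFunc ℂ) ^ (j + 1) • AR (j + 1) + AR 0 := by
      have hs : toRat (∑ j ∈ Finset.range k, (X : ℂ[X]) ^ (j + 1) • const (coeffSeq A (j + 1)))
          = ∑ j ∈ Finset.range k, (RatFunc.X : RatFunc ℂ) ^ (j + 1) • AR (j + 1) := by
        refine (map_sum (algebraMap ℂ[X] (RatFunc ℂ)).mapMatrix _ _).trans
          (Finset.sum_congr rfl fun j _ => ?_)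
        refine (toRat_smul _ _).trans ?_
        rw [map_pow, RatFunc.algebraMap_X]
        rfl
      rw [hP, matPoly_eq_sum, toRat_add, toRat_add, hs, toRat_smul, map_pow, RatFunc.algebraMap_X]
      rfl
    have hterm : ∀ j ∈ Finset.range k,
        ((RatFunc.X : RatFunc ℂ) ^ (k + 1))⁻¹ • (RatFunc.X : RatFunc ℂ) ^ (j + 1) • AR (j + 1)
        = (RatFunc.X : RatFunc ℂ)⁻¹ ^ (k - j) • AR (j + 1) := fun j hj => by
      have hjk : k + 1 = (k - j) + (j + 1) := by
        have := Finset.mem_range.1 hj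
        omega
      rw [smul_smul, hjk, pow_add, mul_inv, mul_assoc, inv_mul_cancel₀ (pow_ne_zero _ hX), mul_one,
        inv_pow]
    rw [Realization.transfer, hPR, ← hH, smul_add, smul_add, smul_add, Finset.smul_sum,
      Finset.sum_congr rfl hterm, smul_smul, inv_mul_cancel₀ (pow_ne_zero _ hX), one_smul, inv_pow,
      smul_sub, smul_neg]
    abel
  rw [hleft, hright]
  exact h'

end Pencils

end
end Fiedler

theorem theorem3p9 (m n r : ℕ) (hm : 1 ≤ m)
    (A : Fin (m + 1) → Matrix (Fin n) (Fin n) ℂ) (hlead : A (Fin.last m) ≠ 0)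
    (S : Fiedler.Realization (Fin n) r) (hP : S.P = Fiedler.matPoly A) (hmin : S.IsMinimal)
    (σ : Equiv.Perm (Fin m)) :
    Fiedler.IsRosenbrockStrongLinearization S (Fiedler.pencilS A S σ) ∧
    Fiedler.SystemEquivalent S (Fiedler.pencilS A S σ) ∧
    ∃ c₀ i₀ : ℕ, Fiedler.HasConsecutions (Fiedler.tuple σ) 0 c₀ ∧
      Fiedler.HasInversions (Fiedler.tuple σ) 0 i₀ ∧
      ∃ T : Fiedler.Realization (Fin m × Fin n) r,
        T.P = Fiedler.pencilP A σ ∧ T.C = Fiedler.blockCol m i₀ S.C ∧ T.E = S.E ∧ T.A = S.A ∧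
        T.B = Fiedler.blockRow m c₀ S.B ∧
        Fiedler.pencilS A S σ = T.systemMatrix ∧
        Fiedler.BiproperEquivalent S.transfer T.transfer := by
  obtain ⟨l₁, l₂, hσ, h₁, h₂, hn₁, hn₂, hlt₁, hlt₂⟩ := Fiedler.exists_tuple_split hm σ
  obtain ⟨k, rfl⟩ : ∃ k, m = k + 1 := ⟨m - 1, by omega⟩
  -- Needed over `ℂ`, `ℂ[X]` and `RatFunc ℂ`, with the same block position in each.
  have hcol : ∀ {R : Type} [CommRing R] (A' : ℕ → Matrix (Fin n) (Fin n) R),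
      Fiedler.genProd (k + 1) 0 A' l₁ * Fiedler.unitCol R n (k + 1) 0
        = Fiedler.unitCol R n (k + 1) (Fiedler.inversionCount l₁) := fun A' =>
    Fiedler.genProd_mul_unitCol (k + 1) k.succ_pos l₁ hlt₁ h₁ hn₁ 0 A'
  have hrow : ∀ {R : Type} [CommRing R] (A' : ℕ → Matrix (Fin n) (Fin n) R),
      Fiedler.unitRow R n (k + 1) 0 * Fiedler.genProd (k + 1) 0 A' l₂
        = Fiedler.unitRow R n (k + 1) (Fiedler.inversionCount l₂.reverse) := fun A' =>
    Fiedler.unitRow_mul_genProd (k + 1) k.succ_pos l₂ hlt₂ h₂ hn₂ 0 A'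
  obtain ⟨U, V, hU, hV, h, hu, hv⟩ :=
    Fiedler.exists_unimodular k A hσ h₁ h₂ (hrow _) (hcol _)
  have hS := Fiedler.pencilS_eq_systemMatrix A S hσ h₁ h₂ (hrow _) (hcol _)
  have hse := Fiedler.systemEquivalent_of_unimodular hP hU hV h hu hv
  have hbe := Fiedler.biproperEquivalent_pencilRealization A S hP hσ h₁ h₂ (hrow _) (hcol _)
  rw [← hS] at hse
  -- The pencil `λM_{-m} - M_σ` has the form `𝒳 - λ𝒴` with `𝒳 = -M_σ` and `𝒴 = -M_{-m}`.
  refine ⟨⟨_, ⟨-(List.ofFn fun j => Fiedler.fiedlerP A (σ j)).prod, -Fiedler.fiedlerPNeg A, ?_⟩, hS,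
    Fiedler.isMinimal_of_unimodular hP hmin h hu hv, hse, hbe⟩, hse, _, _,
    hσ ▸ Fiedler.hasConsecutions_middle l₁ l₂ h₁ h₂ hn₂,
    hσ ▸ Fiedler.hasInversions_middle l₁ l₂ h₁ h₂ hn₁, _, rfl, rfl, rfl, rfl, rfl, hS, hbe⟩
  change Fiedler.pencilP A σ = _
  rw [Fiedler.pencilP, Fiedler.const_neg, Fiedler.const_neg, smul_neg, sub_neg_eq_add, neg_add_eq_sub]
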